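/- **Setting.** Let $n\in\mathbb N$ and consider the Euler–Lagrange system $$\dot x=v,\qquad M(x)\dot v+C(x,v)v+g(x)+D(x)v=u+d(t),\qquad x(t),v(t)\in\mathbb R^n,$$ where $M(x)$ is symmetric positive definite, $M,g,D$ are continuous in $x$, $C$ is continuous in $(x,v)$, and $d$ is bounded and piecewise continuous on $[0,\infty)$ (finitely many discontinuities on each bounded interval, finite one-sided limits). For $i=1,\dots,n$ let the hard bounds $\rho^{hL}_i,\rho^{hU}_i$ and the soft bounds $\rho^{sL}_i,\rho^{sU}_i$ be continuously differentiable functions of time that on $[0,\infty)$ are bounded with bounded derivatives, and suppose that there are $\epsilon^h_i,\epsilon^s_i>0$ with $\rho^{hU}_i-\rho^{hL}_i\ge\epsilon^h_i$ and $\rho^{sU}_i-\rho^{sL}_i\ge\epsilon^s_i$ for all $t\ge0$. Suppose that at $t=0$ the constraints are compatible ($\rho^{hU}_i(0)>\rho^{sL}_i(0)$ and $\rho^{sU}_i(0)>\rho^{hL}_i(0)$) and that the initial position satisfies $\rho^{hL}_i(0)<x_i(0)<\rho^{hU}_i(0)$ and $\rho^{sL}_i(0)<x_i(0)<\rho^{sU}_i(0)$.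 **Funnel planning.** Let $\mu,k_c>0$, $\eta^L_i=\rho^{hU}_i-\rho^{sL}_i$, $\eta^U_i=\rho^{sU}_i-\rho^{hL}_i$, and let $p^L_i,p^U_i$ be solutions on $[0,\infty)$ (continuous, in the sense of the integral equation) of $$\dot p=\tfrac12\bigl(1-\operatorname{sign}(\eta-\mu)\bigr)\frac1{\eta+p}-k_c\,p,\qquad p(0)=0,$$ with $\eta=\eta^L_i$ and $\eta=\eta^U_i$ respectively. Put $\rho^L_i=\max\{\rho^{sL}_i-p^L_i,\rho^{hL}_i\}$ and $\rho^U_i=\min\{\rho^{sU}_i+p^U_i,\rho^{hU}_i\}$. **Controller.** Let $k_x,k_v>0$ and $T(z)=\ln\frac{1+z}{1-z}$. Put $$\hat x_i=\frac{x_i-\frac12(\rho^U_i+\rho^L_i)}{\frac12(\rho^U_i-\rho^L_i)},\quad \xi_{x_i}=\frac{4}{(\rho^U_i-\rho^L_i)(1-\hat x_i^2)},\quad \varepsilon_{x_i}=T(\hat x_i),\quad v_{d,i}=-k_x\,\xi_{x_i}\varepsilon_{x_i},$$ $$e_{v_i}=v_i-v_{d,i},\quad \hat e_{v_i}=\frac{e_{v_i}}{\gamma^v_i},\quad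 \xi_{v_i}=\frac{2}{\gamma^v_i(1-\hat e_{v_i}^2)},\quad \varepsilon_{v_i}=T(\hat e_{v_i}),\quad u_i=-k_v\,\xi_{v_i}\varepsilon_{v_i},$$ where the velocity performance functions $\gamma^v_i$ are continuously differentiable and, on $[0,\infty)$, bounded, bounded below by a positive constant, and with bounded derivative, and are chosen such that $|e_{v_i}(0)|<\gamma^v_i(0)$. The controller uses no knowledge of $M,C,g,D,d$. A solution of the closed loop on $[0,\tau)$, $0<\tau\le\infty$, is a pair $(x,v)$ with the given initial values, $v$ continuous, $\dot x=v$ throughout, and the equation of motion satisfied at every time at which $d$ is continuous. **Theorem.** Under these hypotheses: 1. the closed loop has a solution on $[0,\infty)$, and every solution on some $[0,\tau)$, $0<\tau\le\infty$, extends to a solution on $[0,\infty)$; 2. every solution on $[0,\infty)$ satisfies, for all $t\ge0$ and $i=1,\dots,n$, $$\rho^L_i(t)<x_i(t)<\rho^U_i(t)\qquad\text{and}\qquad|e_{v_i}(t)|<\gamma^v_i(t),$$ and all closed-loop signals $p^L_i,\,p^U_i,\,\rho^L_i,\,\rho^U_i,\,x,\,v,\,\hat x,\,\xi_x,\,\varepsilon_x,\,v_d,\,e_v,\,\hat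 e_v,\,\xi_v,\,\varepsilon_v,\,u$ are bounded on $[0,\infty)$; so is $\dot v$ on the set of times at which $d$ is continuous. -/

import Mathlib

open Set Filter Topology MeasureTheory

noncomputable section

namespace FunnelControl

/-- A scalar time signal that is continuously differentiable and, for `t ≥ 0`, bounded with
bounded derivative. -/
def IsC1Bounded (f : ℝ → ℝ) : Prop :=
  ContDiff ℝ 1 f ∧ (∃ B : ℝ, ∀ t : ℝ, 0 ≤ t → |f t| ≤ B) ∧
    ∃ B : ℝ, ∀ t : ℝ, 0 ≤ t → |deriv f t| ≤ B

/-- A signal that is bounded on `[0, ∞)`. -/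
def IsBoundedSignal {E : Type*} [Norm E] (f : ℝ → E) : Prop :=
  ∃ B : ℝ, ∀ t : ℝ, 0 ≤ t → ‖f t‖ ≤ B

/-- Piecewise continuity on `[0, ∞)`: finitely many discontinuities on every bounded interval, and
finite one-sided limits everywhere. -/
def IsPiecewiseContinuous {n : ℕ} (d : ℝ → Fin n → ℝ) : Prop :=
  (∀ T : ℝ, {t : ℝ | t ∈ Icc 0 T ∧ ¬ ContinuousWithinAt d (Ici 0) t}.Finite) ∧
  (∀ t : ℝ, 0 ≤ t → ∃ l : Fin n → ℝ, Tendsto d (𝓝[>] t) (𝓝 l)) ∧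
  (∀ t : ℝ, 0 < t → ∃ l : Fin n → ℝ, Tendsto d (𝓝[<] t) (𝓝 l))

/-- The Euler-Lagrange plant `M(x) v' + C(x,v) v + g(x) + D(x) v = u + d(t)`, `x' = v`. -/
structure ELSystem (n : ℕ) where
  /-- inertia matrix -/
  M : (Fin n → ℝ) → Matrix (Fin n) (Fin n) ℝ
  /-- centrifugal and Coriolis matrix -/
  C : (Fin n → ℝ) → (Fin n → ℝ) → Matrix (Fin n) (Fin n) ℝ
  /-- gravitational forces -/
  g : (Fin n → ℝ) → Fin n → ℝ
  /-- friction-like terms -/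
  D : (Fin n → ℝ) → Matrix (Fin n) (Fin n) ℝ
  /-- external disturbance -/
  d : ℝ → Fin n → ℝ
  /-- `M(x)` is symmetric and positive definite -/
  posDef_M : ∀ x, (M x).PosDef
  continuous_M : Continuous M
  continuous_C : Continuous (fun p : (Fin n → ℝ) × (Fin n → ℝ) => C p.1 p.2)
  continuous_g : Continuous g
  continuous_D : Continuous D
  bounded_d : IsBoundedSignal d
  piecewiseContinuous_d : IsPiecewiseContinuous d

/-- Time-varying hard constraints `hL i < x i < hU i` and soft constraints `sL i < x i < sU i`,
each pair separately feasible with a positive margin. -/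
structure OutputConstraints (n : ℕ) where
  hL : Fin n → ℝ → ℝ
  hU : Fin n → ℝ → ℝ
  sL : Fin n → ℝ → ℝ
  sU : Fin n → ℝ → ℝ
  hL_c1 : ∀ i, IsC1Bounded (hL i)
  hU_c1 : ∀ i, IsC1Bounded (hU i)
  sL_c1 : ∀ i, IsC1Bounded (sL i)
  sU_c1 : ∀ i, IsC1Bounded (sU i)
  hard_feasible : ∀ i, ∃ ε : ℝ, 0 < ε ∧ ∀ t : ℝ, 0 ≤ t → ε ≤ hU i t - hL i t
  soft_feasible : ∀ i, ∃ ε : ℝ, 0 < ε ∧ ∀ t : ℝ, 0 ≤ t → ε ≤ sU i t - sL i t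

/-- The constraints are compatible at time zero, and the initial output satisfies all of them. -/
def OutputConstraints.InitiallyCompatible {n : ℕ} (R : OutputConstraints n)
    (x₀ : Fin n → ℝ) : Prop :=
  ∀ i, (R.sL i 0 < R.hU i 0 ∧ R.hL i 0 < R.sU i 0) ∧
    (R.hL i 0 < x₀ i ∧ x₀ i < R.hU i 0) ∧ (R.sL i 0 < x₀ i ∧ x₀ i < R.sU i 0)

/-! ### Online funnel planning -/

/-- `ηᴸ = ρʰᵁ - ρˢᴸ`. -/
def OutputConstraints.etaL {n : ℕ} (R : OutputConstraints n) (i : Fin n) (t : ℝ) : ℝ :=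
  R.hU i t - R.sL i t

/-- `ηᵁ = ρˢᵁ - ρʰᴸ`. -/
def OutputConstraints.etaU {n : ℕ} (R : OutputConstraints n) (i : Fin n) (t : ℝ) : ℝ :=
  R.sU i t - R.hL i t

/-- Right-hand side of the modification dynamics
`p' = (1/2) (1 - sign (η - μ)) / (η + p) - k_c p`. -/
def modificationRhs (μ kc η p : ℝ) : ℝ :=
  1 / 2 * (1 - Real.sign (η - μ)) * (1 / (η + p)) - kc * p

/-- `p` solves the modification dynamics on `[0, ∞)` with `p 0 = 0`. As the right-hand side jumps
in time, solutions are understood in the sense of Carathéodory (the integral equation). -/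
structure IsModificationSignal (μ kc : ℝ) (η p : ℝ → ℝ) : Prop where
  continuousOn : ContinuousOn p (Ici 0)
  intervalIntegrable : ∀ t : ℝ, 0 ≤ t →
    IntervalIntegrable (fun s => modificationRhs μ kc (η s) (p s)) volume 0 t
  integral_eq : ∀ t : ℝ, 0 ≤ t → p t = ∫ s in (0 : ℝ)..t, modificationRhs μ kc (η s) (p s)

/-- Lower funnel boundary `max {ρˢᴸ - pᴸ, ρʰᴸ}`. -/
def OutputConstraints.rhoL {n : ℕ} (R : OutputConstraints n) (pL : Fin n → ℝ → ℝ)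
    (i : Fin n) (t : ℝ) : ℝ :=
  max (R.sL i t - pL i t) (R.hL i t)

/-- Upper funnel boundary `min {ρˢᵁ + pᵁ, ρʰᵁ}`. -/
def OutputConstraints.rhoU {n : ℕ} (R : OutputConstraints n) (pU : Fin n → ℝ → ℝ)
    (i : Fin n) (t : ℝ) : ℝ :=
  min (R.sU i t + pU i t) (R.hU i t)

/-! ### The controller

It is built from the funnel boundaries `rL`, `rU`, the velocity performance functions `γ` and the
two gains only: no plant data enter. -/

/-- The error transformation `T(z) = ln ((1 + z) / (1 - z))`, meant for `z ∈ (-1, 1)`. -/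
def T (z : ℝ) : ℝ := Real.log ((1 + z) / (1 - z))

/-- All that the controller knows. -/
structure Controller (n : ℕ) where
  rL : Fin n → ℝ → ℝ
  rU : Fin n → ℝ → ℝ
  γ : Fin n → ℝ → ℝ
  kx : ℝ
  kv : ℝ

namespace Controller

variable {n : ℕ} (K : Controller n)

/-- Normalized output. -/
def xHat (t : ℝ) (x : Fin n → ℝ) (i : Fin n) : ℝ :=
  (x i - 1 / 2 * (K.rU i t + K.rL i t)) / (1 / 2 * (K.rU i t - K.rL i t))

/-- Diagonal entries of `ξ_x`. -/
def xiX (t : ℝ) (x : Fin n → ℝ) (i : Fin n) : ℝ :=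
  4 / ((K.rU i t - K.rL i t) * (1 - K.xHat t x i ^ 2))

/-- Transformed output `ε_x`. -/
def epsX (t : ℝ) (x : Fin n → ℝ) (i : Fin n) : ℝ := T (K.xHat t x i)

/-- Reference velocity `v_d = -k_x ξ_x ε_x`. -/
def vd (t : ℝ) (x : Fin n → ℝ) (i : Fin n) : ℝ := -K.kx * K.xiX t x i * K.epsX t x i

/-- Velocity error. -/
def ev (t : ℝ) (x v : Fin n → ℝ) (i : Fin n) : ℝ := v i - K.vd t x i

/-- Normalized velocity error. -/
def evHat (t : ℝ) (x v : Fin n → ℝ) (i : Fin n) : ℝ := K.ev t x v i / K.γ i t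

/-- Diagonal entries of `ξ_v`. -/
def xiV (t : ℝ) (x v : Fin n → ℝ) (i : Fin n) : ℝ :=
  2 / (K.γ i t * (1 - K.evHat t x v i ^ 2))

/-- Transformed velocity error `ε_v`. -/
def epsV (t : ℝ) (x v : Fin n → ℝ) (i : Fin n) : ℝ := T (K.evHat t x v i)

/-- Control input `u = -k_v ξ_v ε_v`. -/
def u (t : ℝ) (x v : Fin n → ℝ) (i : Fin n) : ℝ := -K.kv * K.xiV t x v i * K.epsV t x v i

end Controller

/-- The time interval `[0, τ)`, where `τ = ⊤` gives `[0, ∞)`. -/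
def timeInterval (τ : EReal) : Set ℝ := {t : ℝ | 0 ≤ t ∧ (t : EReal) < τ}

/-- `(x, v)` is a solution on `[0, τ)` of the plant `S` in feedback with the controller `K`, with
initial state `(x₀, v₀)`: `v` is continuous, `x' = v`, and the equation of motion holds at all times
at which the disturbance is continuous (derivatives at time zero are one-sided).
It is not required that the state stay where the controller is meant to operate. -/
structure IsClosedLoopSolution {n : ℕ} (S : ELSystem n) (K : Controller n)
    (x₀ v₀ : Fin n → ℝ) (τ : EReal) (x v : ℝ → Fin n → ℝ) : Prop where
  init_x : x 0 = x₀
  init_v : v 0 = v₀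
  continuousOn_v : ContinuousOn v (timeInterval τ)
  deriv_x : ∀ t ∈ timeInterval τ, HasDerivWithinAt x (v t) (Ici 0) t
  motion : ∀ t ∈ timeInterval τ, ContinuousWithinAt S.d (Ici 0) t →
    ∃ a : Fin n → ℝ, HasDerivWithinAt v a (Ici 0) t ∧
      (S.M (x t)).mulVec a + (S.C (x t) (v t)).mulVec (v t) + S.g (x t)
        + (S.D (x t)).mulVec (v t) = K.u t (x t) (v t) + S.d t

/-- Boundedness on `[0, ∞)` of all signals of the closed loop along `(x, v)`. -/
structure AllSignalsBounded {n : ℕ} (S : ELSystem n) (K : Controller n)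
    (pL pU : Fin n → ℝ → ℝ) (x v : ℝ → Fin n → ℝ) : Prop where
  pL_bdd : ∀ i, IsBoundedSignal (pL i)
  pU_bdd : ∀ i, IsBoundedSignal (pU i)
  rL_bdd : ∀ i, IsBoundedSignal (K.rL i)
  rU_bdd : ∀ i, IsBoundedSignal (K.rU i)
  x_bdd : IsBoundedSignal x
  v_bdd : IsBoundedSignal v
  acceleration_bdd : ∃ B : ℝ, ∀ t : ℝ, 0 ≤ t → ContinuousWithinAt S.d (Ici 0) t →
    ‖derivWithin v (Ici 0) t‖ ≤ B
  xHat_bdd : IsBoundedSignal (fun t => K.xHat t (x t))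
  xiX_bdd : IsBoundedSignal (fun t => K.xiX t (x t))
  epsX_bdd : IsBoundedSignal (fun t => K.epsX t (x t))
  vd_bdd : IsBoundedSignal (fun t => K.vd t (x t))
  ev_bdd : IsBoundedSignal (fun t => K.ev t (x t) (v t))
  evHat_bdd : IsBoundedSignal (fun t => K.evHat t (x t) (v t))
  xiV_bdd : IsBoundedSignal (fun t => K.xiV t (x t) (v t))
  epsV_bdd : IsBoundedSignal (fun t => K.epsV t (x t) (v t))
  u_bdd : IsBoundedSignal (fun t => K.u t (x t) (v t))

end FunnelControl

end

/-!
The closed loop is analysed through distances to the funnel boundaries, and every estimate is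
arranged to survive the two defects of the data: the planned boundaries are Lipschitz but not
differentiable, and the closed-loop vector field is discontinuous in time, merely continuous in the
state, and singular at the boundaries.

*Planning.* The sum `η + p` of a modification signal stays above a positive constant, because near
zero the repelling term `1 / (η + p)` is active and dominates
(`IsModificationSignal.exists_le_add`). Hence `p` is bounded and Lipschitz, and the planned funnel
has Lipschitz boundaries and a width bounded below (`exists_regularFunnel`).

*Position.* As long as the velocity error stays in its funnel, `x' = v_d + e_v` with `e_v` bounded,
and `v_d` exceeds any given speed near the boundaries, so that the boundaries cannot be approached
beyond a fixed distance (`RegularFunnel.exists_position_margin`). Such statements follow from a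
barrier argument without derivatives, `le_of_nondecreasing_below`.

*Velocity.* With the position at a fixed distance from its boundaries, `v_d` is bounded and
Lipschitz along trajectories. The energy `½ ‖ε_v‖²` is then Lipschitz in time, and almost everywhere
its derivative is at most `-k_v sᵀ M⁻¹ s + c ‖s‖`, where `s = ξ_v ε_v`; the form `M⁻¹` is uniformly
positive on the bounded set of admissible positions, so the energy decreases above a certain level
(`RegularFunnel.exists_energy_level`). This confines the normalized velocity error to a compact part
of `(-1, 1)`.

*Closing the loop.* Each of the two estimates presupposes the conclusion of the other up to the
present time. They combine to margins that hold as long as the halved margins hold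
(`RegularFunnel.exists_margins`), and by continuous induction
(`RegularFunnel.inMargin_of_step`) these margins hold along every solution. All signals are bounded
inside the margins (`RegularFunnel.exists_bounds`).

*Existence and extension.* Clamping the state to the halved margins gives a bounded vector field,
continuous in the state and measurable in time. Peano's theorem for such fields
(`exists_integral_solution`) is proved by Euler polygons, a diagonal subsequence and dominated
convergence. The a priori margins show that the clamps are never active along its solutions. A
solution given on `[0, τ)` is extended by applying the theorem to a field that follows the given
solution before `τ` (`RegularFunnel.exists_truncated_extension`), so that no limit at `τ` has to be
taken.
-/

noncomputable section

namespace FunnelControl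

/-! ### Barrier arguments on the real line -/

/-- A barrier argument without derivatives: `f` cannot fall below `m` if it does not decrease over
any time interval that it spends below `m`. -/
theorem le_of_nondecreasing_below {f : ℝ → ℝ} {s m : ℝ} (hf : ContinuousOn f (Icc 0 s))
    (h0 : m ≤ f 0)
    (H : ∀ σ t, 0 ≤ σ → σ ≤ t → t ≤ s → (∀ r ∈ Icc σ t, f r ≤ m) → f σ ≤ f t) :
    ∀ t ∈ Icc 0 s, m ≤ f t := by
  intro t ht
  by_contra hlt
  push Not at hlt
  have hft : ContinuousOn f (Icc 0 t) := hf.mono (Icc_subset_Icc_right ht.2)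
  have hA : IsCompact (Icc 0 t ∩ f ⁻¹' Ici m) :=
    isCompact_Icc.of_isClosed_subset (hft.preimage_isClosed_of_isClosed isClosed_Icc isClosed_Ici)
      inter_subset_left
  obtain ⟨σ, ⟨hσ, hσm⟩, hmax⟩ := hA.exists_isGreatest ⟨0, ⟨⟨le_rfl, ht.1⟩, h0⟩⟩
  have hσm : m ≤ f σ := hσm
  obtain ⟨r, hr, hrm⟩ := intermediate_value_Icc' hσ.2
    (hft.mono (Icc_subset_Icc_left hσ.1)) ⟨hlt.le, hσm⟩
  have hrσ : r = σ := le_antisymm (hmax ⟨⟨hσ.1.trans hr.1, hr.2⟩, hrm.ge⟩) hr.1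
  subst hrσ
  have := H r t hσ.1 hσ.2 ht.2 fun q hq => by
    by_contra hq'
    push Not at hq'
    have := hmax ⟨⟨hσ.1.trans hq.1, hq.2⟩, hq'.le⟩
    have : q = r := le_antisymm this hq.1
    subst this
    exact absurd hrm hq'.ne'
  linarith

/-- The barrier argument `le_of_nondecreasing_below` when the hypothesis on `f` is known only as
long as `f` has stayed above a lower level `m₀ < m`. -/
theorem le_of_nondecreasing_between {f : ℝ → ℝ} {s m₀ m : ℝ} (hf : ContinuousOn f (Icc 0 s))
    (hm : m₀ < m) (h0 : m ≤ f 0)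
    (H : ∀ σ t, 0 ≤ σ → σ ≤ t → t ≤ s → (∀ r ∈ Icc 0 t, m₀ ≤ f r) →
      (∀ r ∈ Icc σ t, f r ≤ m) → f σ ≤ f t) :
    ∀ t ∈ Icc 0 s, m ≤ f t := by
  rcases lt_or_ge s 0 with hs | hs
  · intro t ht
    exact absurd (ht.1.trans ht.2) (not_le.2 hs)
  have key : Icc 0 s ⊆ {t | ∀ r ∈ Icc 0 t, r ≤ s → m ≤ f r} := by
    refine IsClosed.Icc_subset_of_forall_exists_gt ?_ ?_ ?_
    · have : {t | ∀ r ∈ Icc 0 t, r ≤ s → m ≤ f r} ∩ Icc 0 s =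
          Icc 0 s ∩ ⋂ r : {r // r ∈ Icc 0 s ∧ f r < m}, Iic r.1 := by
        ext t
        simp only [mem_inter_iff, mem_ofPred_eq, mem_iInter, mem_Iic, Subtype.forall]
        constructor
        · rintro ⟨h1, h2⟩
          refine ⟨h2, fun r hr => ?_⟩
          by_contra hrt
          push Not at hrt
          exact absurd (h1 r ⟨hr.1.1, hrt.le⟩ hr.1.2) (not_le.2 hr.2)
        · rintro ⟨h1, h2⟩
          refine ⟨fun r hr hrs => ?_, h1⟩
          by_contra hrm
          push Not at hrm
          have h3 := h2 r ⟨⟨hr.1, hrs⟩, hrm⟩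
          have h4 : t = r := le_antisymm h3 hr.2
          subst h4
          have hpos : 0 < t := lt_of_le_of_ne h1.1 (by rintro rfl; exact absurd h0 (not_le.2 hrm))
          -- just before `t`, the function is still below `m`
          have hct : ContinuousWithinAt f (Icc 0 s) t := hf t h1
          have h5 : ∀ᶠ q in 𝓝[Icc 0 s] t, f q < m := hct.eventually_lt_const hrm
          have h6 : ∀ᶠ q in 𝓝[<] t, f q < m ∧ q ∈ Ioo 0 t := by
            refine Filter.Eventually.and ?_ (Ioo_mem_nhdsLT hpos)
            rw [← nhdsWithin_Ioo_eq_nhdsLT hpos]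
            have hsub : Ioo 0 t ⊆ Icc 0 s := fun q hq => ⟨hq.1.le, hq.2.le.trans h1.2⟩
            exact h5.filter_mono (nhdsWithin_mono _ hsub)
          obtain ⟨q, hq1, hq2⟩ := h6.exists
          exact absurd (h2 q ⟨⟨hq2.1.le, hq2.2.le.trans h1.2⟩, hq1⟩) (not_le.2 hq2.2)
      rw [this]
      exact isClosed_Icc.inter (isClosed_iInter fun r => isClosed_Iic)
    · intro r hr _
      have : r = 0 := le_antisymm hr.2 hr.1
      rwa [this]
    · rintro t ⟨htm, ht⟩ y hy
      have hct : ContinuousWithinAt f (Icc 0 s) t := hf t ⟨ht.1, ht.2.le⟩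
      have h1 : ∀ᶠ q in 𝓝[Icc 0 s] t, m₀ < f q :=
        hct.eventually_const_lt (hm.trans_le (htm t ⟨ht.1, le_rfl⟩ ht.2.le))
      have h2 : ∀ᶠ q in 𝓝[≥] t, q ∈ Icc 0 s → m₀ < f q :=
        (eventually_nhdsWithin_iff.1 h1).filter_mono nhdsWithin_le_nhds
      obtain ⟨u, hu, hu'⟩ := (mem_nhdsGE_iff_exists_Icc_subset).1 h2
      have htu : t < u := hu
      have hy : t < y := hy
      set y' := min (min u y) s
      have hty' : t < y' := lt_min (lt_min htu hy) ht.2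
      have hy's : y' ≤ s := min_le_right _ _
      refine ⟨y', ?_, hty', (min_le_left _ _).trans (min_le_right _ _)⟩
      have hlow : ∀ r ∈ Icc 0 y', m₀ ≤ f r := by
        intro r hr
        rcases le_total r t with hrt | hrt
        · exact (hm.trans_le (htm r ⟨hr.1, hrt⟩ (hr.2.trans hy's))).le
        · exact (hu' ⟨hrt, hr.2.trans ((min_le_left _ _).trans (min_le_left _ _))⟩
            ⟨hr.1, hr.2.trans hy's⟩).le
      intro r hr _
      refine le_of_nondecreasing_below (hf.mono (Icc_subset_Icc_right hy's)) h0 ?_ r hr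
      intro σ t' h1 h2 h3 h4
      exact H σ t' h1 h2 (h3.trans hy's) (fun r hr => hlow r ⟨hr.1, hr.2.trans h3⟩) h4
  intro t ht
  exact key ht t ⟨ht.1, le_rfl⟩ ht.2

theorem le_of_ae_deriv_nonpos {f : ℝ → ℝ} {a b : ℝ} (hab : a ≤ b)
    (hf : AbsolutelyContinuousOnInterval f a b)
    (h : ∀ᵐ t, t ∈ Icc a b → deriv f t ≤ 0) : f b ≤ f a := by
  have h1 := hf.integral_deriv_eq_sub
  have h2 : ∫ x in a..b, deriv f x ≤ 0 := by
    rw [intervalIntegral.integral_of_le hab]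
    refine setIntegral_nonpos_of_ae_restrict ?_
    rw [EventuallyLE, ae_restrict_iff' measurableSet_Ioc]
    filter_upwards [h] with t ht hta
    exact ht ⟨hta.1.le, hta.2⟩
  linarith

/-! ### Peano's existence theorem -/

section Peano

variable {E : Type*} [NormedAddCommGroup E]

/-- The Arzelà–Ascoli theorem on the line for uniformly Lipschitz sequences, in pointwise form:
a diagonal subsequence converges on the rationals, hence everywhere. -/
theorem exists_subseq_tendsto_of_lipschitz [ProperSpace E] {C : NNReal} (y : ℕ → ℝ → E) (y₀ : E)
    (hy : ∀ k, LipschitzWith C (y k)) (hy0 : ∀ k, y k 0 = y₀) :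
    ∃ (φ : ℕ → ℕ) (Y : ℝ → E), StrictMono φ ∧ LipschitzWith C Y ∧
      ∀ t, Tendsto (fun k => y (φ k) t) atTop (𝓝 (Y t)) := by
  have hK : IsCompact (Set.pi univ fun q : ℚ => Metric.closedBall y₀ (C * |(q : ℝ)|)) :=
    isCompact_univ_pi fun q => isCompact_closedBall _ _
  obtain ⟨g, -, φ, hφ, hg⟩ := hK.tendsto_subseq (x := fun (k : ℕ) (q : ℚ) => y k q) fun k q _ => by
    rw [Metric.mem_closedBall, ← hy0 k]
    have := (hy k).dist_le_mul (q : ℝ) 0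
    rwa [Real.dist_eq, sub_zero] at this
  have hq : ∀ q : ℚ, Tendsto (fun k => y (φ k) q) atTop (𝓝 (g q)) := fun q =>
    (tendsto_pi_nhds.1 hg) q
  have hcau : ∀ t : ℝ, CauchySeq fun k => y (φ k) t := by
    intro t
    rw [Metric.cauchySeq_iff]
    intro ε hε
    have hC : (0 : ℝ) < C + 1 := by positivity
    obtain ⟨q, hq1, hq2⟩ := exists_rat_btwn (show t < t + ε / (3 * (C + 1)) by
      have : 0 < ε / (3 * (C + 1)) := by positivity
      linarith)
    have hd : C * |t - q| ≤ ε / 3 := by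
      have h1 : |t - q| ≤ ε / (3 * (C + 1)) := by rw [abs_sub_comm, abs_of_nonneg] <;> linarith
      calc C * |t - q| ≤ (C + 1) * (ε / (3 * (C + 1))) := by gcongr; linarith
        _ = ε / 3 := by field_simp
    obtain ⟨N, hN⟩ := Metric.cauchySeq_iff.1 (hq q).cauchySeq (ε / 3) (by positivity)
    refine ⟨N, fun m hm k hk => ?_⟩
    have h1 := (hy (φ m)).dist_le_mul t q
    have h2 := (hy (φ k)).dist_le_mul q t
    rw [Real.dist_eq] at h1 h2
    rw [abs_sub_comm] at h2
    have h3 := hN m hm k hk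
    have h4 := dist_triangle4 (y (φ m) t) (y (φ m) q) (y (φ k) q) (y (φ k) t)
    linarith
  choose Y hY using fun t => cauchySeq_tendsto_of_complete (hcau t)
  refine ⟨φ, Y, hφ, LipschitzWith.of_dist_le_mul fun s t => ?_, hY⟩
  exact le_of_tendsto ((hY s).dist (hY t))
    (Eventually.of_forall fun k => (hy (φ k)).dist_le_mul s t)

variable [NormedSpace ℝ E]

/-- Nodes of the Euler polygon with step `h` for the field `F`: each step integrates the field in
time with the state frozen. -/
def eulerNode (F : ℝ → E → E) (y₀ : E) (h : ℝ) : ℕ → E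
  | 0 => y₀
  | j + 1 => eulerNode F y₀ h j + ∫ s in (j * h)..((j + 1 : ℕ) * h), F s (eulerNode F y₀ h j)

theorem lipschitzWith_add_integral {B : ℝ} (f : ℝ → E) (y₀ : E) (hB : ∀ s, ‖f s‖ ≤ B)
    (hm : AEStronglyMeasurable f volume) :
    LipschitzWith B.toNNReal (fun t => y₀ + ∫ s in (0 : ℝ)..t, f s) := by
  have hi : ∀ a b : ℝ, IntervalIntegrable f volume a b := fun a b =>
    (intervalIntegrable_const (c := B)).mono_fun hm.restrict
      (Eventually.of_forall fun s => (hB s).trans (le_abs_self B))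
  have hB0 : 0 ≤ B := (norm_nonneg _).trans (hB 0)
  refine LipschitzWith.of_dist_le_mul fun t u => ?_
  rw [dist_add_left, dist_eq_norm, intervalIntegral.integral_interval_sub_left (hi _ _) (hi _ _),
    Real.coe_toNNReal B hB0, Real.dist_eq]
  exact intervalIntegral.norm_integral_le_of_norm_le_const fun s _ => hB s

/-- The Euler polygons are uniformly Lipschitz approximate solutions. -/
theorem exists_approximate_solution (F : ℝ → E → E) {B : ℝ} (hB : ∀ s z, ‖F s z‖ ≤ B)
    (hmeas : ∀ z : ℝ → E, StronglyMeasurable z →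
      AEStronglyMeasurable (fun s => F s (z s)) volume)
    (y₀ : E) {h : ℝ} (hh : 0 < h) :
    ∃ c : ℝ → E, StronglyMeasurable c ∧
      ∀ s, 0 ≤ s → ‖(y₀ + ∫ r in (0 : ℝ)..s, F r (c r)) - c s‖ ≤ B * h := by
  have hB0 : 0 ≤ B := (norm_nonneg _).trans (hB 0 0)
  set z := eulerNode F y₀ h with hz
  set c : ℝ → E := fun s => z ⌊s / h⌋₊ with hc
  have hcm : StronglyMeasurable c := by
    have h1 : Measurable fun s : ℝ => ⌊s / h⌋₊ :=
      Nat.measurable_floor.comp (measurable_id.div_const h)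
    exact (StronglyMeasurable.of_discrete (f := z)).comp_measurable h1
  have hm := hmeas c hcm
  have hi : ∀ a b : ℝ, IntervalIntegrable (fun s => F s (c s)) volume a b := fun a b =>
    (intervalIntegrable_const (c := B)).mono_fun hm.restrict
      (Eventually.of_forall fun s => (hB s _).trans (le_abs_self B))
  have hlip := lipschitzWith_add_integral (fun s => F s (c s)) y₀ (fun s => hB s _) hm
  have hnode : ∀ j : ℕ, y₀ + ∫ r in (0 : ℝ)..(j * h), F r (c r) = z j := by
    intro j
    induction j with
    | zero => simp [hz, eulerNode]
    | succ j ih =>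
      rw [← intervalIntegral.integral_add_adjacent_intervals (hi 0 (j * h)) (hi _ _), ← add_assoc,
        ih]
      have : z (j + 1) = z j + ∫ s in (j * h)..((j + 1 : ℕ) * h), F s (z j) := rfl
      rw [this]
      congr 1
      have hle : (j : ℝ) * h ≤ (j + 1 : ℕ) * h := by push_cast; nlinarith
      rw [intervalIntegral.integral_of_le hle, intervalIntegral.integral_of_le hle,
        integral_Ioc_eq_integral_Ioo, integral_Ioc_eq_integral_Ioo]
      refine setIntegral_congr_fun measurableSet_Ioo fun s hs => ?_
      have : ⌊s / h⌋₊ = j := by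
        rw [Nat.floor_eq_iff (div_nonneg ((by positivity : (0:ℝ) ≤ j * h).trans hs.1.le) hh.le),
          le_div_iff₀ hh, div_lt_iff₀ hh]
        exact ⟨hs.1.le, by simpa using hs.2⟩
      simp only [hc, this]
  refine ⟨c, hcm, fun s hs => ?_⟩
  have h1 := hlip.dist_le_mul s (⌊s / h⌋₊ * h)
  rw [hnode, dist_eq_norm, Real.coe_toNNReal B hB0, Real.dist_eq] at h1
  refine h1.trans (mul_le_mul_of_nonneg_left ?_ hB0)
  have h2 : (⌊s / h⌋₊ : ℝ) ≤ s / h := Nat.floor_le (div_nonneg hs hh.le)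
  have h3 : s / h < ⌊s / h⌋₊ + 1 := Nat.lt_floor_add_one _
  rw [le_div_iff₀ hh] at h2
  rw [div_lt_iff₀ hh] at h3
  rw [abs_of_nonneg (by linarith)]
  linarith

/-- **Peano's theorem** for a bounded field that is continuous in the state and merely measurable
in time. Boundedness makes the solution global. -/
theorem exists_integral_solution [ProperSpace E] (F : ℝ → E → E) {B : ℝ}
    (hB : ∀ s z, ‖F s z‖ ≤ B) (hcont : ∀ s, Continuous (F s))
    (hmeas : ∀ z : ℝ → E, StronglyMeasurable z →
      AEStronglyMeasurable (fun s => F s (z s)) volume) (y₀ : E) :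
    ∃ Y : ℝ → E, LipschitzWith B.toNNReal Y ∧
      ∀ t, 0 ≤ t → Y t = y₀ + ∫ s in (0 : ℝ)..t, F s (Y s) := by
  have hh : ∀ k : ℕ, (0 : ℝ) < 1 / ((k : ℝ) + 1) := fun k => by positivity
  choose c hcm hc using fun k : ℕ => exists_approximate_solution F hB hmeas y₀ (hh k)
  obtain ⟨φ, Y, hφ, hY, hlim⟩ := exists_subseq_tendsto_of_lipschitz
    (fun k t => y₀ + ∫ s in (0 : ℝ)..t, F s (c k s)) y₀
    (fun k => lipschitzWith_add_integral _ y₀ (fun s => hB s _) (hmeas _ (hcm k))) (by simp)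
  refine ⟨Y, hY, fun t ht => ?_⟩
  have hsmall : Tendsto (fun k => B * (1 / ((φ k : ℝ) + 1))) atTop (𝓝 0) := by
    have h1 : Tendsto (fun k : ℕ => 1 / ((k : ℝ) + 1)) atTop (𝓝 0) :=
      tendsto_one_div_add_atTop_nhds_zero_nat
    simpa using (h1.comp hφ.tendsto_atTop).const_mul B
  have hcl : ∀ s, 0 ≤ s → Tendsto (fun k => c (φ k) s) atTop (𝓝 (Y s)) := by
    intro s hs
    have h1 : Tendsto (fun k => (y₀ + ∫ r in (0 : ℝ)..s, F r (c (φ k) r)) - c (φ k) s) atTop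
        (𝓝 0) := squeeze_zero_norm (fun k => hc (φ k) s hs) hsmall
    simpa using (hlim s).sub h1
  have h2 : Tendsto (fun k => ∫ s in (0 : ℝ)..t, F s (c (φ k) s)) atTop
      (𝓝 (∫ s in (0 : ℝ)..t, F s (Y s))) := by
    refine intervalIntegral.tendsto_integral_filter_of_dominated_convergence (fun _ => B)
      (Eventually.of_forall fun k => (hmeas _ (hcm _)).restrict)
      (Eventually.of_forall fun k => Eventually.of_forall fun s _ => hB s _)
      intervalIntegrable_const (Eventually.of_forall fun s hs => ?_)
    rw [uIoc_of_le ht] at hs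
    exact ((hcont s).tendsto _).comp (hcl s hs.1.le)
  exact tendsto_nhds_unique (hlim t) (tendsto_const_nhds.add h2)

end Peano

/-! ### Bounded Lipschitz signals and funnel planning -/

/-- A scalar signal that is bounded and Lipschitz on `[0, ∞)`. This is the regularity shared by all
funnel boundaries: the planned ones need not be differentiable. -/
def IsLipschitzSignal (f : ℝ → ℝ) : Prop :=
  (∃ B : ℝ, ∀ t : ℝ, 0 ≤ t → |f t| ≤ B) ∧
    ∃ L : ℝ, ∀ s t : ℝ, 0 ≤ s → 0 ≤ t → |f s - f t| ≤ L * |s - t|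

namespace IsLipschitzSignal

variable {f g : ℝ → ℝ}

theorem add (hf : IsLipschitzSignal f) (hg : IsLipschitzSignal g) :
    IsLipschitzSignal (fun t => f t + g t) := by
  obtain ⟨⟨B, hB⟩, L, hL⟩ := hf
  obtain ⟨⟨B', hB'⟩, L', hL'⟩ := hg
  refine ⟨⟨B + B', fun t ht => (abs_add_le _ _).trans (add_le_add (hB t ht) (hB' t ht))⟩,
    L + L', fun s t hs ht => ?_⟩
  rw [add_sub_add_comm, add_mul]
  exact (abs_add_le _ _).trans (add_le_add (hL s t hs ht) (hL' s t hs ht))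

theorem neg (hf : IsLipschitzSignal f) : IsLipschitzSignal (fun t => - f t) := by
  obtain ⟨⟨B, hB⟩, L, hL⟩ := hf
  refine ⟨⟨B, fun t ht => by rw [abs_neg]; exact hB t ht⟩, L, fun s t hs ht => ?_⟩
  rw [← neg_sub', abs_neg]
  exact hL s t hs ht

theorem sub (hf : IsLipschitzSignal f) (hg : IsLipschitzSignal g) :
    IsLipschitzSignal (fun t => f t - g t) := by
  simpa only [sub_eq_add_neg] using hf.add hg.neg

theorem max (hf : IsLipschitzSignal f) (hg : IsLipschitzSignal g) :
    IsLipschitzSignal (fun t => max (f t) (g t)) := by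
  obtain ⟨⟨B, hB⟩, L, hL⟩ := hf
  obtain ⟨⟨B', hB'⟩, L', hL'⟩ := hg
  refine ⟨⟨Max.max B B', fun t ht => abs_max_le_max_abs_abs.trans
    (max_le_max (hB t ht) (hB' t ht))⟩, Max.max L L', fun s t hs ht => ?_⟩
  refine (abs_max_sub_max_le_max _ _ _ _).trans (max_le ((hL s t hs ht).trans ?_)
    ((hL' s t hs ht).trans ?_))
  · exact mul_le_mul_of_nonneg_right (le_max_left _ _) (abs_nonneg _)
  · exact mul_le_mul_of_nonneg_right (le_max_right _ _) (abs_nonneg _)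

theorem min (hf : IsLipschitzSignal f) (hg : IsLipschitzSignal g) :
    IsLipschitzSignal (fun t => min (f t) (g t)) := by
  have h := (hf.neg.max hg.neg).neg
  simpa only [max_neg_neg, neg_neg] using h

end IsLipschitzSignal

theorem IsC1Bounded.isLipschitzSignal {f : ℝ → ℝ} (hf : IsC1Bounded f) : IsLipschitzSignal f := by
  obtain ⟨hc, hB, L, hL⟩ := hf
  refine ⟨hB, L, fun s t hs ht => ?_⟩
  have h := (convex_Ici (0 : ℝ)).norm_image_sub_le_of_norm_deriv_le (f := f) (C := L)
    (fun x _ => hc.differentiable (by norm_num) x) (fun x hx => hL x hx) (mem_Ici.2 ht)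
    (mem_Ici.2 hs)
  simpa [Real.norm_eq_abs] using h

section Modification

variable {μ kc : ℝ} {η p : ℝ → ℝ}

theorem sign_factor_mem (z : ℝ) :
    0 ≤ 1 / 2 * (1 - Real.sign z) ∧ 1 / 2 * (1 - Real.sign z) ≤ 1 := by
  rcases Real.sign_apply_eq z with h | h | h <;> rw [h] <;> norm_num

namespace IsModificationSignal

theorem intervalIntegrable' (hp : IsModificationSignal μ kc η p) {s t : ℝ} (hs : 0 ≤ s)
    (ht : 0 ≤ t) :
    IntervalIntegrable (fun r => modificationRhs μ kc (η r) (p r)) volume s t :=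
  (hp.intervalIntegrable s hs).symm.trans (hp.intervalIntegrable t ht)

theorem sub_eq_integral (hp : IsModificationSignal μ kc η p) {s t : ℝ} (hs : 0 ≤ s) (ht : 0 ≤ t) :
    p t - p s = ∫ r in s..t, modificationRhs μ kc (η r) (p r) := by
  rw [hp.integral_eq t ht, hp.integral_eq s hs, intervalIntegral.integral_interval_sub_left
    (hp.intervalIntegrable t ht) (hp.intervalIntegrable s hs)]

theorem mul_le_sub (hp : IsModificationSignal μ kc η p) {s t c : ℝ} (hs : 0 ≤ s) (hst : s ≤ t)
    (h : ∀ r ∈ Icc s t, c ≤ modificationRhs μ kc (η r) (p r)) : c * (t - s) ≤ p t - p s := by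
  rw [hp.sub_eq_integral hs (hs.trans hst)]
  have := intervalIntegral.integral_mono_on (μ := volume) hst
    (intervalIntegrable_const (c := c)) (hp.intervalIntegrable' hs (hs.trans hst)) h
  rw [intervalIntegral.integral_const, smul_eq_mul] at this
  linarith

theorem sub_le_mul (hp : IsModificationSignal μ kc η p) {s t c : ℝ} (hs : 0 ≤ s) (hst : s ≤ t)
    (h : ∀ r ∈ Icc s t, modificationRhs μ kc (η r) (p r) ≤ c) : p t - p s ≤ c * (t - s) := by
  rw [hp.sub_eq_integral hs (hs.trans hst)]
  have := intervalIntegral.integral_mono_on (μ := volume) hst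
    (hp.intervalIntegrable' hs (hs.trans hst)) (intervalIntegrable_const (c := c)) h
  rw [intervalIntegral.integral_const, smul_eq_mul] at this
  linarith

theorem map_zero (hp : IsModificationSignal μ kc η p) : p 0 = 0 := by
  simpa using hp.integral_eq 0 le_rfl

theorem continuousOn_Icc (hp : IsModificationSignal μ kc η p) (s : ℝ) :
    ContinuousOn p (Icc 0 s) :=
  hp.continuousOn.mono Icc_subset_Ici_self

theorem nonneg_of_add_nonneg (hp : IsModificationSignal μ kc η p) (hkc : 0 < kc) {s : ℝ}
    (h : ∀ r ∈ Icc 0 s, 0 ≤ η r + p r) : ∀ t ∈ Icc 0 s, 0 ≤ p t := by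
  refine le_of_nondecreasing_below (hp.continuousOn_Icc s) hp.map_zero.ge ?_
  intro σ t h0 h1 h2 h3
  have := hp.mul_le_sub (c := 0) h0 h1 fun r hr => by
    have h4 := h r ⟨h0.trans hr.1, hr.2.trans h2⟩
    have h5 := mul_nonneg (sign_factor_mem (η r - μ)).1 (one_div_nonneg.2 h4)
    have h6 := h3 r hr
    unfold modificationRhs
    nlinarith
  linarith

/-- The sum `η + p` never comes near the singularity of the modification dynamics: where it is
small, `η < μ` because `p` is nonnegative, so that the repelling term `1 / (η + p)` is active and
outweighs the rest. -/
theorem exists_le_add (hp : IsModificationSignal μ kc η p) (hμ : 0 < μ) (hkc : 0 < kc)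
    (hη : IsLipschitzSignal η) (h0 : 0 < η 0) :
    ∃ δ, 0 < δ ∧ ∀ t, 0 ≤ t → δ ≤ η t + p t := by
  obtain ⟨⟨B, hB⟩, L, hL⟩ := hη
  have hB0 : 0 ≤ B := (abs_nonneg _).trans (hB 0 le_rfl)
  have hL0 : 0 ≤ L := by simpa using (abs_nonneg _).trans (hL 1 0 zero_le_one le_rfl)
  set N := kc * (1 + B) + L + 1 with hN
  have hN0 : 0 < N := by positivity
  set δ := min (min (μ / 2) 1) (min (η 0) (1 / N)) with hδ
  have hδ0 : 0 < δ := by positivity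
  have hδμ : δ ≤ μ / 2 := (min_le_left _ _).trans (min_le_left _ _)
  have hδ1 : δ ≤ 1 := (min_le_left _ _).trans (min_le_right _ _)
  have hδη : δ ≤ η 0 := (min_le_right _ _).trans (min_le_left _ _)
  have hδN : δ ≤ 1 / N := (min_le_right _ _).trans (min_le_right _ _)
  have hηc : ContinuousOn η (Ici 0) := by
    refine LipschitzOnWith.continuousOn (K := L.toNNReal) (LipschitzOnWith.of_dist_le_mul ?_)
    intro s hs t ht
    rw [Real.dist_eq, Real.dist_eq, Real.coe_toNNReal L hL0]
    exact hL s t hs ht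
  refine ⟨δ, hδ0, fun T hT => ?_⟩
  refine le_of_nondecreasing_between (f := fun t => η t + p t) (s := T) (m₀ := δ / 2)
    ((hηc.mono Icc_subset_Ici_self).add (hp.continuousOn_Icc T)) (by linarith)
    (by simpa [hp.map_zero] using hδη) ?_ T ⟨hT, le_rfl⟩
  intro σ t hσ hσt htT hlow hup
  have hpn : ∀ r ∈ Icc 0 t, 0 ≤ p r := hp.nonneg_of_add_nonneg hkc fun r hr => by
    have := hlow r hr
    linarith
  have h1 : L * (t - σ) ≤ p t - p σ := by
    refine hp.mul_le_sub hσ hσt fun r hr => ?_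
    have hr0 : 0 ≤ r := hσ.trans hr.1
    have hq0 := hlow r ⟨hr0, hr.2⟩
    have hq1 := hup r hr
    have hpr := hpn r ⟨hr0, hr.2⟩
    have hηr := (abs_le.1 (hB r hr0)).1
    have hsign : Real.sign (η r - μ) = -1 := Real.sign_of_neg (by linarith)
    have hrep : N ≤ 1 / (η r + p r) := by
      rw [le_div_iff₀ (by linarith)]
      rw [le_div_iff₀ hN0] at hδN
      nlinarith
    unfold modificationRhs
    rw [hsign]
    have : kc * p r ≤ kc * (1 + B) := mul_le_mul_of_nonneg_left (by linarith) hkc.le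
    linarith
  have h2 := hL σ t hσ (hσ.trans hσt)
  rw [abs_sub_comm σ t, abs_of_nonneg (by linarith : 0 ≤ t - σ)] at h2
  have h3 := (abs_le.1 h2).2
  linarith

theorem isLipschitzSignal (hp : IsModificationSignal μ kc η p) (hkc : 0 < kc) {δ : ℝ}
    (hδ : 0 < δ) (h : ∀ t, 0 ≤ t → δ ≤ η t + p t) : IsLipschitzSignal p := by
  have hpn : ∀ t, 0 ≤ t → 0 ≤ p t := fun t ht =>
    hp.nonneg_of_add_nonneg hkc (s := t) (fun r hr => hδ.le.trans (h r hr.1)) t ⟨ht, le_rfl⟩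
  have hrep : ∀ t, 0 ≤ t → 0 ≤ 1 / 2 * (1 - Real.sign (η t - μ)) * (1 / (η t + p t)) ∧
      1 / 2 * (1 - Real.sign (η t - μ)) * (1 / (η t + p t)) ≤ 1 / δ := by
    intro t ht
    obtain ⟨h1, h2⟩ := sign_factor_mem (η t - μ)
    have h3 : 1 / (η t + p t) ≤ 1 / δ := one_div_le_one_div_of_le hδ (h t ht)
    have h4 : 0 ≤ 1 / (η t + p t) := one_div_nonneg.2 (hδ.le.trans (h t ht))
    exact ⟨mul_nonneg h1 h4, by nlinarith⟩
  set P := 1 / δ / kc with hP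
  have hPk : kc * P = 1 / δ := by rw [hP]; field_simp
  have hP0 : 0 ≤ P := by positivity
  have hpP : ∀ t, 0 ≤ t → p t ≤ P := by
    intro t ht
    have := le_of_nondecreasing_below (f := fun t => - p t) (s := t) (m := -P)
      (hp.continuousOn_Icc t).neg (by simpa [hp.map_zero] using hP0) ?_ t ⟨ht, le_rfl⟩
    · linarith
    · intro σ r h0 h1 _ h3
      have := hp.sub_le_mul (c := 0) h0 h1 fun q hq => by
        have h4 := (hrep q (h0.trans hq.1)).2
        have h5 := h3 q hq
        have h6 : kc * P ≤ kc * p q := mul_le_mul_of_nonneg_left (by linarith) hkc.le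
        unfold modificationRhs
        linarith
      linarith
  refine ⟨⟨P, fun t ht => abs_le.2 ⟨by linarith [hpn t ht], hpP t ht⟩⟩, 1 / δ, fun s t hs ht => ?_⟩
  rw [hp.sub_eq_integral ht hs, ← Real.norm_eq_abs]
  refine intervalIntegral.norm_integral_le_of_norm_le_const fun r hr => ?_
  have hr0 : 0 ≤ r := (le_min ht hs).trans (uIoc_subset_uIcc hr).1
  have h1 : kc * p r ≤ kc * P := mul_le_mul_of_nonneg_left (hpP r hr0) hkc.le
  have h2 : 0 ≤ kc * p r := mul_nonneg hkc.le (hpn r hr0)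
  have h3 := hrep r hr0
  rw [Real.norm_eq_abs, abs_le]
  unfold modificationRhs
  constructor <;> linarith

end IsModificationSignal

end Modification

/-- The properties of the funnels on which the closed-loop analysis rests: boundaries and
performance functions are bounded by `A` and `L`-Lipschitz, and the width of the position funnel
and the performance functions are at least `δ`. The gains are positive. -/
structure RegularFunnel {n : ℕ} (K : Controller n) (A L δ : ℝ) : Prop where
  A_pos : 0 < A
  L_nonneg : 0 ≤ L
  δ_pos : 0 < δ
  kx_pos : 0 < K.kx
  kv_pos : 0 < K.kv
  abs_rL_le : ∀ i t, 0 ≤ t → |K.rL i t| ≤ A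
  abs_rU_le : ∀ i t, 0 ≤ t → |K.rU i t| ≤ A
  abs_γ_le : ∀ i t, 0 ≤ t → |K.γ i t| ≤ A
  lip_rL : ∀ i s t, 0 ≤ s → 0 ≤ t → |K.rL i s - K.rL i t| ≤ L * |s - t|
  lip_rU : ∀ i s t, 0 ≤ s → 0 ≤ t → |K.rU i s - K.rU i t| ≤ L * |s - t|
  lip_γ : ∀ i s t, 0 ≤ s → 0 ≤ t → |K.γ i s - K.γ i t| ≤ L * |s - t|
  le_gap : ∀ i t, 0 ≤ t → δ ≤ K.rU i t - K.rL i t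
  le_γ : ∀ i t, 0 ≤ t → δ ≤ K.γ i t

/-- Finitely many signals have common bounds. -/
theorem exists_uniform_bounds {ι : Type*} [Finite ι] {f : ι → ℝ → ℝ}
    (hf : ∀ i, IsLipschitzSignal (f i)) :
    ∃ A L : ℝ, 0 ≤ A ∧ 0 ≤ L ∧ (∀ i t, 0 ≤ t → |f i t| ≤ A) ∧
      ∀ i s t, 0 ≤ s → 0 ≤ t → |f i s - f i t| ≤ L * |s - t| := by
  choose A hA using fun i => (hf i).1
  choose L hL using fun i => (hf i).2
  obtain ⟨A', hA'⟩ := Finite.exists_le A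
  obtain ⟨L', hL'⟩ := Finite.exists_le L
  refine ⟨max A' 0, max L' 0, le_max_right _ _, le_max_right _ _, fun i t ht => ?_,
    fun i s t hs ht => ?_⟩
  · exact (hA i t ht).trans ((hA' i).trans (le_max_left _ _))
  · exact (hL i s t hs ht).trans
      (mul_le_mul_of_nonneg_right ((hL' i).trans (le_max_left _ _)) (abs_nonneg _))

theorem exists_uniform_lower_bound {ι : Type*} [Finite ι] {f : ι → ℝ → ℝ}
    (hf : ∀ i, ∃ ε, 0 < ε ∧ ∀ t, 0 ≤ t → ε ≤ f i t) :
    ∃ ε, 0 < ε ∧ ∀ i t, 0 ≤ t → ε ≤ f i t := by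
  choose e he h using hf
  obtain ⟨m, hm⟩ := Finite.exists_le fun i => (e i)⁻¹
  refine ⟨(max m 1)⁻¹, by positivity, fun i t ht => le_trans ?_ (h i t ht)⟩
  exact inv_le_of_inv_le₀ (he i) ((hm i).trans (le_max_left _ _))

variable {n : ℕ}

theorem isLipschitzSignal_modification {μ kc : ℝ} (hμ : 0 < μ) (hkc : 0 < kc) {η p : ℝ → ℝ}
    (hη : IsLipschitzSignal η) (h0 : 0 < η 0) (hp : IsModificationSignal μ kc η p) :
    IsLipschitzSignal p := by
  obtain ⟨δ, hδ, h⟩ := hp.exists_le_add hμ hkc hη h0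
  exact hp.isLipschitzSignal hkc hδ h

/-- The planned funnel is regular: its width is the least of `ρʰᵁ - ρʰᴸ`, `ηᴸ + pᴸ`, `ηᵁ + pᵁ` and
`ρˢᵁ - ρˢᴸ + pᴸ + pᵁ`. -/
theorem exists_regularFunnel (R : OutputConstraints n) {x₀ : Fin n → ℝ}
    (h_init : R.InitiallyCompatible x₀) {μ kc : ℝ} (hμ : 0 < μ) (hkc : 0 < kc)
    {pL pU : Fin n → ℝ → ℝ}
    (hpL : ∀ i, IsModificationSignal μ kc (R.etaL i) (pL i))
    (hpU : ∀ i, IsModificationSignal μ kc (R.etaU i) (pU i))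
    (K : Controller n) (hrL : K.rL = R.rhoL pL) (hrU : K.rU = R.rhoU pU)
    (hkx : 0 < K.kx) (hkv : 0 < K.kv) (hγ : ∀ i, IsC1Bounded (K.γ i))
    (hγ_pos : ∀ i, ∃ c : ℝ, 0 < c ∧ ∀ t : ℝ, 0 ≤ t → c ≤ K.γ i t) :
    ∃ A L δ, RegularFunnel K A L δ := by
  have hhL := fun i => (R.hL_c1 i).isLipschitzSignal
  have hhU := fun i => (R.hU_c1 i).isLipschitzSignal
  have hsL := fun i => (R.sL_c1 i).isLipschitzSignal
  have hsU := fun i => (R.sU_c1 i).isLipschitzSignal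
  have hηL : ∀ i, IsLipschitzSignal (R.etaL i) := fun i => (hhU i).sub (hsL i)
  have hηU : ∀ i, IsLipschitzSignal (R.etaU i) := fun i => (hsU i).sub (hhL i)
  have hηL0 : ∀ i, 0 < R.etaL i 0 := fun i => sub_pos.2 (h_init i).1.1
  have hηU0 : ∀ i, 0 < R.etaU i 0 := fun i => sub_pos.2 (h_init i).1.2
  have hpL' := fun i => isLipschitzSignal_modification hμ hkc (hηL i) (hηL0 i) (hpL i)
  have hpU' := fun i => isLipschitzSignal_modification hμ hkc (hηU i) (hηU0 i) (hpU i)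
  have hL' : ∀ i, IsLipschitzSignal (K.rL i) := fun i => by
    rw [hrL]
    exact ((hsL i).sub (hpL' i)).max (hhL i)
  have hU' : ∀ i, IsLipschitzSignal (K.rU i) := fun i => by
    rw [hrU]
    exact ((hsU i).add (hpU' i)).min (hhU i)
  obtain ⟨A₁, L₁, hA₁, hL₁, hb₁, hl₁⟩ := exists_uniform_bounds hL'
  obtain ⟨A₂, L₂, hA₂, hL₂, hb₂, hl₂⟩ := exists_uniform_bounds hU'
  obtain ⟨A₃, L₃, hA₃, hL₃, hb₃, hl₃⟩ := exists_uniform_bounds fun i => (hγ i).isLipschitzSignal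
  obtain ⟨δ₁, hδ₁, hd₁⟩ := exists_uniform_lower_bound hγ_pos
  obtain ⟨δ₂, hδ₂, hd₂⟩ : ∃ ε, 0 < ε ∧ ∀ i t, 0 ≤ t → ε ≤ K.rU i t - K.rL i t := by
    refine exists_uniform_lower_bound fun i => ?_
    obtain ⟨ε₁, hε₁, h₁⟩ := R.hard_feasible i
    obtain ⟨ε₂, hε₂, h₂⟩ := R.soft_feasible i
    obtain ⟨ε₃, hε₃, h₃⟩ := (hpL i).exists_le_add hμ hkc (hηL i) (hηL0 i)
    obtain ⟨ε₄, hε₄, h₄⟩ := (hpU i).exists_le_add hμ hkc (hηU i) (hηU0 i)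
    refine ⟨min (min ε₁ ε₂) (min ε₃ ε₄), by positivity, fun t ht => ?_⟩
    have q₁ := ((min_le_left (min ε₁ ε₂) (min ε₃ ε₄)).trans (min_le_left _ _)).trans (h₁ t ht)
    have q₂ := ((min_le_left (min ε₁ ε₂) (min ε₃ ε₄)).trans (min_le_right _ _)).trans (h₂ t ht)
    have q₃ := ((min_le_right (min ε₁ ε₂) (min ε₃ ε₄)).trans (min_le_left _ _)).trans (h₃ t ht)
    have q₄ := ((min_le_right (min ε₁ ε₂) (min ε₃ ε₄)).trans (min_le_right _ _)).trans (h₄ t ht)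
    have pl : 0 ≤ pL i t := (hpL i).nonneg_of_add_nonneg hkc (s := t)
      (fun r hr => hε₃.le.trans (h₃ r hr.1)) t ⟨ht, le_rfl⟩
    have pu : 0 ≤ pU i t := (hpU i).nonneg_of_add_nonneg hkc (s := t)
      (fun r hr => hε₄.le.trans (h₄ r hr.1)) t ⟨ht, le_rfl⟩
    unfold OutputConstraints.etaL at q₃
    unfold OutputConstraints.etaU at q₄
    rw [hrL, hrU, OutputConstraints.rhoL, OutputConstraints.rhoU, le_sub_iff_add_le,
      ← le_sub_iff_add_le', max_le_iff]
    constructor <;> rw [le_sub_iff_add_le, ← le_sub_iff_add_le', le_sub_iff_add_le, le_min_iff] <;>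
      constructor <;> linarith
  have hA₂₃ : A₂ ≤ max A₂ A₃ := le_max_left _ _
  have hA₃₂ : A₃ ≤ max A₂ A₃ := le_max_right _ _
  have lip : ∀ {f : ℝ → ℝ} {s t l : ℝ}, |f s - f t| ≤ l * |s - t| → l ≤ L₁ + L₂ + L₃ →
      |f s - f t| ≤ (L₁ + L₂ + L₃) * |s - t| := fun h hl =>
    h.trans (mul_le_mul_of_nonneg_right hl (abs_nonneg _))
  exact ⟨A₁ + A₂ + A₃ + 1, L₁ + L₂ + L₃, min δ₁ δ₂,
    { A_pos := by positivity
      L_nonneg := by positivity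
      δ_pos := by positivity
      kx_pos := hkx
      kv_pos := hkv
      abs_rL_le := fun i t ht => (hb₁ i t ht).trans (by linarith)
      abs_rU_le := fun i t ht => (hb₂ i t ht).trans (by linarith)
      abs_γ_le := fun i t ht => (hb₃ i t ht).trans (by linarith)
      lip_rL := fun i s t hs ht => lip (hl₁ i s t hs ht) (by linarith)
      lip_rU := fun i s t hs ht => lip (hl₂ i s t hs ht) (by linarith)
      lip_γ := fun i s t hs ht => lip (hl₃ i s t hs ht) (by linarith)
      le_gap := fun i t ht => (min_le_right _ _).trans (hd₂ i t ht)
      le_γ := fun i t ht => (min_le_left _ _).trans (hd₁ i t ht) }⟩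

/-! ### The controller in terms of the distances to the funnel boundaries -/

theorem T_eq {z : ℝ} (h1 : -1 < z) (h2 : z < 1) : T z = Real.log (1 + z) - Real.log (1 - z) :=
  Real.log_div (by linarith) (by linarith)

theorem abs_T_le {z θ : ℝ} (hθ : 0 < θ) (hz : |z| ≤ 1 - θ) :
    |T z| ≤ |Real.log θ| + Real.log 2 := by
  obtain ⟨h1, h2⟩ := abs_le.1 hz
  rw [T_eq (by linarith) (by linarith)]
  have h3 : Real.log θ ≤ Real.log (1 + z) := Real.log_le_log hθ (by linarith)
  have h4 : Real.log θ ≤ Real.log (1 - z) := Real.log_le_log hθ (by linarith)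
  have h5 : Real.log (1 + z) ≤ Real.log 2 := Real.log_le_log (by linarith) (by linarith)
  have h6 : Real.log (1 - z) ≤ Real.log 2 := Real.log_le_log (by linarith) (by linarith)
  have h7 := neg_abs_le (Real.log θ)
  rw [abs_le]
  constructor <;> linarith

/-- Bounds on `T` confine its argument to a compact part of `(-1, 1)`. -/
theorem abs_le_of_abs_T_le {z e : ℝ} (hz : |z| < 1) (h : |T z| ≤ e) : |z| ≤ 1 - Real.exp (-e) := by
  obtain ⟨h1, h2⟩ := abs_lt.1 hz
  obtain ⟨h3, h4⟩ := abs_le.1 h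
  rw [T_eq h1 h2] at h3 h4
  have he : 0 ≤ e := (abs_nonneg _).trans h
  have he1 : Real.exp (-e) ≤ 1 := Real.exp_le_one_iff.2 (by linarith)
  rw [abs_le]
  constructor
  · rcases le_total 0 z with hz0 | hz0
    · linarith
    · have h5 : 0 ≤ Real.log (1 - z) := Real.log_nonneg (by linarith)
      have h6 : -e ≤ Real.log (1 + z) := by linarith
      have := (Real.le_log_iff_exp_le (by linarith)).1 h6
      linarith
  · rcases le_total z 0 with hz0 | hz0
    · linarith
    · have h5 : 0 ≤ Real.log (1 + z) := Real.log_nonneg (by linarith)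
      have h6 : -e ≤ Real.log (1 - z) := by linarith
      have := (Real.le_log_iff_exp_le (by linarith)).1 h6
      linarith

/-- The position feedback as a function of the distances `a`, `b` to the lower and to the upper
funnel boundary: `v_d = -k_x Θ(a, b)`. -/
def distanceFeedback (a b : ℝ) : ℝ := (1 / a + 1 / b) * (Real.log a - Real.log b)

namespace Controller

variable (K : Controller n) {t : ℝ} {x : Fin n → ℝ} {i : Fin n}

theorem one_add_and_one_sub_xHat (ha : 0 < x i - K.rL i t) (hb : 0 < K.rU i t - x i) :
    1 + K.xHat t x i = 2 * (x i - K.rL i t) / (K.rU i t - K.rL i t) ∧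
      1 - K.xHat t x i = 2 * (K.rU i t - x i) / (K.rU i t - K.rL i t) := by
  have hw : K.rU i t - K.rL i t ≠ 0 := by linarith
  unfold xHat
  constructor <;> field_simp <;> ring

theorem xHat_mem (ha : 0 < x i - K.rL i t) (hb : 0 < K.rU i t - x i) : |K.xHat t x i| < 1 := by
  obtain ⟨h1, h2⟩ := K.one_add_and_one_sub_xHat ha hb
  have hw : 0 < K.rU i t - K.rL i t := by linarith
  have h3 : 0 < 1 + K.xHat t x i := by rw [h1]; positivity
  have h4 : 0 < 1 - K.xHat t x i := by rw [h2]; positivity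
  rw [abs_lt]
  constructor <;> linarith

theorem xiX_eq (ha : 0 < x i - K.rL i t) (hb : 0 < K.rU i t - x i) :
    K.xiX t x i = 1 / (x i - K.rL i t) + 1 / (K.rU i t - x i) := by
  obtain ⟨h1, h2⟩ := K.one_add_and_one_sub_xHat ha hb
  have hw : 0 < K.rU i t - K.rL i t := by linarith
  have h3 : 1 - K.xHat t x i ^ 2 = (1 + K.xHat t x i) * (1 - K.xHat t x i) := by ring
  unfold xiX
  rw [h3, h1, h2]
  have := ha.ne'
  have := hb.ne'
  have := hw.ne'
  field_simp
  ring

theorem epsX_eq (ha : 0 < x i - K.rL i t) (hb : 0 < K.rU i t - x i) :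
    K.epsX t x i = Real.log (x i - K.rL i t) - Real.log (K.rU i t - x i) := by
  obtain ⟨h1, h2⟩ := K.one_add_and_one_sub_xHat ha hb
  have hw : 0 < K.rU i t - K.rL i t := by linarith
  rw [← Real.log_div ha.ne' hb.ne']
  unfold epsX T
  rw [h1, h2]
  congr 1
  have := hb.ne'
  field_simp

theorem vd_eq (ha : 0 < x i - K.rL i t) (hb : 0 < K.rU i t - x i) :
    K.vd t x i = -K.kx * distanceFeedback (x i - K.rL i t) (K.rU i t - x i) := by
  unfold vd distanceFeedback
  rw [K.xiX_eq ha hb, K.epsX_eq ha hb]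
  ring

/-- The position `x` and the velocity `v` keep, at time `t`, the distance `w` from the boundaries
of the position funnel and the relative distance `θ` from those of the velocity funnel. -/
def InMargin (w θ t : ℝ) (x v : Fin n → ℝ) : Prop :=
  ∀ i, (w ≤ x i - K.rL i t ∧ w ≤ K.rU i t - x i) ∧ |K.evHat t x v i| ≤ 1 - θ

end Controller

theorem Controller.InMargin.mono {K : Controller n} {w w' θ θ' t : ℝ} {x v : Fin n → ℝ}
    (h : K.InMargin w θ t x v) (hw : w' ≤ w) (hθ : θ' ≤ θ) : K.InMargin w' θ' t x v := fun i =>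
  ⟨⟨hw.trans (h i).1.1, hw.trans (h i).1.2⟩, (h i).2.trans (by linarith)⟩

/-- The acceleration that the equation of motion imposes under the total force `f`. -/
def ELSystem.response (S : ELSystem n) (x v f : Fin n → ℝ) : Fin n → ℝ :=
  (S.M x)⁻¹.mulVec (f - (S.C x v).mulVec v - S.g x - (S.D x).mulVec v)

/-- The acceleration of the plant `S` in feedback with the controller `K`. -/
def closedLoopAccel (S : ELSystem n) (K : Controller n) (t : ℝ) (x v : Fin n → ℝ) : Fin n → ℝ :=
  S.response x v (K.u t x v + S.d t)

theorem motion_iff (S : ELSystem n) (K : Controller n) (t : ℝ) (x v a : Fin n → ℝ) :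
    (S.M x).mulVec a + (S.C x v).mulVec v + S.g x + (S.D x).mulVec v = K.u t x v + S.d t ↔
      a = closedLoopAccel S K t x v := by
  have hdet : IsUnit (S.M x).det := (S.posDef_M x).isUnit.map Matrix.detMonoidHom
  unfold closedLoopAccel ELSystem.response
  constructor
  · intro h
    rw [← h]
    have : (S.M x).mulVec a + (S.C x v).mulVec v + S.g x + (S.D x).mulVec v -
        (S.C x v).mulVec v - S.g x - (S.D x).mulVec v = (S.M x).mulVec a := by abel
    rw [this, Matrix.mulVec_mulVec, Matrix.nonsing_inv_mul _ hdet, Matrix.one_mulVec]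
  · rintro rfl
    rw [Matrix.mulVec_mulVec, Matrix.mul_nonsing_inv _ hdet, Matrix.one_mulVec]
    abel

theorem ELSystem.continuous_inv (S : ELSystem n) : Continuous fun x => (S.M x)⁻¹ := by
  have hdet : ∀ x, (S.M x).det ≠ 0 := fun x => (S.posDef_M x).det_pos.ne'
  simp_rw [Matrix.inv_def, Ring.inverse_eq_inv']
  exact (S.continuous_M.matrix_det.inv₀ hdet).smul S.continuous_M.matrix_adjugate

theorem ELSystem.continuous_response (S : ELSystem n) :
    Continuous fun p : (Fin n → ℝ) × (Fin n → ℝ) × (Fin n → ℝ) => S.response p.1 p.2.1 p.2.2 := by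
  unfold ELSystem.response
  have hC : Continuous fun p : (Fin n → ℝ) × (Fin n → ℝ) × (Fin n → ℝ) => S.C p.1 p.2.1 :=
    S.continuous_C.comp (continuous_fst.prodMk continuous_snd.fst)
  exact (S.continuous_inv.comp continuous_fst).matrix_mulVec
    (((continuous_snd.snd.sub (hC.matrix_mulVec continuous_snd.fst)).sub
      (S.continuous_g.comp continuous_fst)).sub
      ((S.continuous_D.comp continuous_fst).matrix_mulVec continuous_snd.fst))

/-! ### Boundedness away from the funnel boundaries -/

section Bounds

variable {K : Controller n} {A L δ : ℝ}

/-- Bounds on the signals of the position loop. -/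
theorem RegularFunnel.exists_position_bounds (hK : RegularFunnel K A L δ) {w : ℝ} (hw : 0 < w) :
    ∃ B, 0 ≤ B ∧ ∀ t, 0 ≤ t → ∀ (x : Fin n → ℝ) i,
      w ≤ x i - K.rL i t → w ≤ K.rU i t - x i →
      |x i| ≤ B ∧ |K.xHat t x i| ≤ B ∧ |K.xiX t x i| ≤ B ∧ |K.epsX t x i| ≤ B ∧
        |K.vd t x i| ≤ B := by
  set e := |Real.log w| + |Real.log (2 * A)| with he
  have he0 : 0 ≤ e := by positivity
  have hA := hK.A_pos
  have hkx := hK.kx_pos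
  set B := A + 1 + 2 / w + 2 * e + K.kx * (2 / w) * (2 * e) with hB
  have hB1 : 0 ≤ K.kx * (2 / w) * (2 * e) := by positivity
  have hB2 : 0 ≤ 2 / w := by positivity
  refine ⟨B, by positivity, fun t ht x i ha hb => ?_⟩
  have ha0 := hw.trans_le ha
  have hb0 := hw.trans_le hb
  have hL := abs_le.1 (hK.abs_rL_le i t ht)
  have hU := abs_le.1 (hK.abs_rU_le i t ht)
  have hlog : ∀ a : ℝ, w ≤ a → a ≤ 2 * A → |Real.log a| ≤ e := by
    intro a h1 h2
    have h3 := Real.log_le_log hw h1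
    have h4 := Real.log_le_log (hw.trans_le h1) h2
    have := neg_abs_le (Real.log w)
    have := le_abs_self (Real.log (2 * A))
    have := abs_nonneg (Real.log w)
    have := abs_nonneg (Real.log (2 * A))
    rw [abs_le]
    constructor <;> linarith
  have hxi : |K.xiX t x i| ≤ 2 / w := by
    have h1 := one_div_le_one_div_of_le hw ha
    have h2 := one_div_le_one_div_of_le hw hb
    have h3 := one_div_pos.2 ha0
    have h4 := one_div_pos.2 hb0
    rw [K.xiX_eq ha0 hb0, abs_of_pos (by linarith)]
    have : 2 / w = 1 / w + 1 / w := by ring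
    linarith
  have heps : |K.epsX t x i| ≤ 2 * e := by
    rw [K.epsX_eq ha0 hb0]
    have h1 := hlog _ ha (by linarith)
    have h2 := hlog _ hb (by linarith)
    exact (abs_sub _ _).trans (by linarith)
  have hvd : |K.vd t x i| ≤ K.kx * (2 / w) * (2 * e) := by
    unfold Controller.vd
    rw [abs_mul, abs_mul, abs_neg, abs_of_pos hkx]
    gcongr
  have hx : |x i| ≤ A := abs_le.2 ⟨by linarith, by linarith⟩
  have hxh := (K.xHat_mem ha0 hb0).le
  refine ⟨?_, ?_, ?_, ?_, ?_⟩ <;> linarith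

/-- Bounds on the signals of the velocity loop. -/
theorem RegularFunnel.exists_velocity_bounds (hK : RegularFunnel K A L δ) {θ : ℝ} (hθ : 0 < θ) :
    ∃ B, 0 ≤ B ∧ ∀ t, 0 ≤ t → ∀ (x v : Fin n → ℝ) i, |K.evHat t x v i| ≤ 1 - θ →
      |K.evHat t x v i| ≤ B ∧ |K.xiV t x v i| ≤ B ∧ |K.epsV t x v i| ≤ B ∧ |K.u t x v i| ≤ B := by
  have hδ := hK.δ_pos
  have hkv := hK.kv_pos
  set e := |Real.log θ| + Real.log 2 with he
  have he0 : 0 ≤ e := add_nonneg (abs_nonneg _) (Real.log_nonneg (by norm_num))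
  have h1 : 0 ≤ 2 / (δ * θ) := by positivity
  have h2 : 0 ≤ K.kv * (2 / (δ * θ)) * e := by positivity
  refine ⟨1 + 2 / (δ * θ) + e + K.kv * (2 / (δ * θ)) * e, by positivity,
    fun t ht x v i h => ?_⟩
  have hγ := hK.le_γ i t ht
  have heps : |K.epsV t x v i| ≤ e := abs_T_le hθ h
  have hxi : |K.xiV t x v i| ≤ 2 / (δ * θ) := by
    have h3 : θ ≤ 1 - K.evHat t x v i ^ 2 := by
      rw [← sq_abs]
      nlinarith [abs_nonneg (K.evHat t x v i)]
    have h4 : δ * θ ≤ K.γ i t * (1 - K.evHat t x v i ^ 2) :=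
      mul_le_mul hγ h3 hθ.le (hδ.le.trans hγ)
    have h5 : 0 < δ * θ := by positivity
    unfold Controller.xiV
    rw [abs_of_nonneg (div_nonneg zero_le_two (h5.le.trans h4))]
    gcongr
  have hu : |K.u t x v i| ≤ K.kv * (2 / (δ * θ)) * e := by
    unfold Controller.u
    rw [abs_mul, abs_mul, abs_neg, abs_of_pos hkv]
    gcongr
  refine ⟨?_, ?_, ?_, ?_⟩ <;> linarith

theorem ev_eq_evHat_mul (hK : RegularFunnel K A L δ) {t : ℝ} (ht : 0 ≤ t) (x v : Fin n → ℝ)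
    (i : Fin n) : K.ev t x v i = K.evHat t x v i * K.γ i t := by
  have := (hK.δ_pos.trans_le (hK.le_γ i t ht)).ne'
  unfold Controller.evHat
  field_simp

theorem RegularFunnel.abs_ev_le (hK : RegularFunnel K A L δ) {t : ℝ} (ht : 0 ≤ t)
    {x v : Fin n → ℝ} {i : Fin n} (h : |K.evHat t x v i| ≤ 1) : |K.ev t x v i| ≤ A := by
  rw [ev_eq_evHat_mul hK ht, abs_mul]
  have := hK.abs_γ_le i t ht
  have := mul_le_mul h this (abs_nonneg _) zero_le_one
  linarith

theorem norm_le_of_forall_abs_le {f : Fin n → ℝ} {B : ℝ} (hB : 0 ≤ B) (h : ∀ i, |f i| ≤ B) :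
    ‖f‖ ≤ B :=
  (pi_norm_le_iff_of_nonneg hB).2 h

/-- The response of the plant is bounded as long as position, velocity and force are. -/
theorem ELSystem.exists_response_bound (S : ELSystem n) (r : ℝ) :
    ∃ B, 0 ≤ B ∧ ∀ x v f : Fin n → ℝ, ‖x‖ ≤ r → ‖v‖ ≤ r → ‖f‖ ≤ r → ‖S.response x v f‖ ≤ B := by
  obtain ⟨B, hB⟩ := (isCompact_closedBall (0 : (Fin n → ℝ) × (Fin n → ℝ) × (Fin n → ℝ))
    r).exists_bound_of_continuousOn S.continuous_response.continuousOn
  refine ⟨max B 0, le_max_right _ _, fun x v f hx hv hf => ?_⟩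
  refine (hB (x, v, f) ?_).trans (le_max_left _ _)
  rw [mem_closedBall_zero_iff]
  exact max_le hx (max_le hv hf)

/-- All signals are bounded at a distance from the funnel boundaries. -/
theorem RegularFunnel.exists_bounds (hK : RegularFunnel K A L δ) (S : ELSystem n) {w θ : ℝ}
    (hw : 0 < w) (hθ : 0 < θ) :
    ∃ B, 0 ≤ B ∧ ∀ t, 0 ≤ t → ∀ x v : Fin n → ℝ, K.InMargin w θ t x v →
      ‖x‖ ≤ B ∧ ‖v‖ ≤ B ∧ ‖K.xHat t x‖ ≤ B ∧ ‖K.xiX t x‖ ≤ B ∧ ‖K.epsX t x‖ ≤ B ∧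
      ‖K.vd t x‖ ≤ B ∧ ‖K.ev t x v‖ ≤ B ∧ ‖K.evHat t x v‖ ≤ B ∧ ‖K.xiV t x v‖ ≤ B ∧
      ‖K.epsV t x v‖ ≤ B ∧ ‖K.u t x v‖ ≤ B ∧ ‖closedLoopAccel S K t x v‖ ≤ B := by
  obtain ⟨B₁, hB₁, h₁⟩ := hK.exists_position_bounds hw
  obtain ⟨B₂, hB₂, h₂⟩ := hK.exists_velocity_bounds hθ
  obtain ⟨D, hD⟩ := S.bounded_d
  obtain ⟨B₃, hB₃, h₃⟩ := S.exists_response_bound (B₁ + A + B₂ + |D|)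
  have hA := hK.A_pos
  refine ⟨B₁ + A + B₂ + B₃, by positivity, fun t ht x v h => ?_⟩
  have hD' : ‖S.d t‖ ≤ |D| := (hD t ht).trans (le_abs_self D)
  have hx : ∀ i, _ := fun i => h₁ t ht x i (h i).1.1 (h i).1.2
  have hv : ∀ i, _ := fun i => h₂ t ht x v i (h i).2
  have hev : ∀ i, |K.ev t x v i| ≤ A := fun i => hK.abs_ev_le ht ((h i).2.trans (by linarith))
  have hvel : ‖v‖ ≤ B₁ + A := norm_le_of_forall_abs_le (by positivity) fun i => by
    have : v i = K.vd t x i + K.ev t x v i := by unfold Controller.ev; ring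
    rw [this]
    exact (abs_add_le _ _).trans (add_le_add (hx i).2.2.2.2 (hev i))
  have n₁ : ‖x‖ ≤ B₁ := norm_le_of_forall_abs_le hB₁ fun i => (hx i).1
  have n₂ : ‖K.xHat t x‖ ≤ B₁ := norm_le_of_forall_abs_le hB₁ fun i => (hx i).2.1
  have n₃ : ‖K.xiX t x‖ ≤ B₁ := norm_le_of_forall_abs_le hB₁ fun i => (hx i).2.2.1
  have n₄ : ‖K.epsX t x‖ ≤ B₁ := norm_le_of_forall_abs_le hB₁ fun i => (hx i).2.2.2.1
  have n₅ : ‖K.vd t x‖ ≤ B₁ := norm_le_of_forall_abs_le hB₁ fun i => (hx i).2.2.2.2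
  have n₆ : ‖K.ev t x v‖ ≤ A := norm_le_of_forall_abs_le hA.le hev
  have n₇ : ‖K.evHat t x v‖ ≤ B₂ := norm_le_of_forall_abs_le hB₂ fun i => (hv i).1
  have n₈ : ‖K.xiV t x v‖ ≤ B₂ := norm_le_of_forall_abs_le hB₂ fun i => (hv i).2.1
  have n₉ : ‖K.epsV t x v‖ ≤ B₂ := norm_le_of_forall_abs_le hB₂ fun i => (hv i).2.2.1
  have n₀ : ‖K.u t x v‖ ≤ B₂ := norm_le_of_forall_abs_le hB₂ fun i => (hv i).2.2.2
  have hD0 := abs_nonneg D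
  have hacc : ‖closedLoopAccel S K t x v‖ ≤ B₃ := h₃ x v _ (by linarith) (by linarith)
    ((norm_add_le _ _).trans (by linarith))
  refine ⟨?_, ?_, ?_, ?_, ?_, ?_, ?_, ?_, ?_, ?_, ?_, ?_⟩ <;> linarith

end Bounds

variable {K : Controller n} {A L δ : ℝ}

/-! ### Continuity of the controller -/

theorem continuousOn_Ici_of_abs_sub_le {f : ℝ → ℝ} (hL : 0 ≤ L)
    (h : ∀ s t, 0 ≤ s → 0 ≤ t → |f s - f t| ≤ L * |s - t|) : ContinuousOn f (Ici 0) := by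
  refine LipschitzOnWith.continuousOn (K := L.toNNReal) (LipschitzOnWith.of_dist_le_mul ?_)
  intro s hs t ht
  rw [Real.dist_eq, Real.dist_eq, Real.coe_toNNReal L hL]
  exact h s t hs ht

namespace RegularFunnel

theorem continuousOn_rL (hK : RegularFunnel K A L δ) (i : Fin n) : ContinuousOn (K.rL i) (Ici 0) :=
  continuousOn_Ici_of_abs_sub_le hK.L_nonneg (hK.lip_rL i)

theorem continuousOn_rU (hK : RegularFunnel K A L δ) (i : Fin n) : ContinuousOn (K.rU i) (Ici 0) :=
  continuousOn_Ici_of_abs_sub_le hK.L_nonneg (hK.lip_rU i)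

theorem continuousOn_γ (hK : RegularFunnel K A L δ) (i : Fin n) : ContinuousOn (K.γ i) (Ici 0) :=
  continuousOn_Ici_of_abs_sub_le hK.L_nonneg (hK.lip_γ i)

section

variable {X : Type*} [TopologicalSpace X] {s : Set X} {p : X} {τ : X → ℝ} {x v : X → Fin n → ℝ}

theorem continuousWithinAt_vd (hK : RegularFunnel K A L δ) (hp : p ∈ s)
    (hτ : ContinuousWithinAt τ s p) (hτ0 : ∀ q ∈ s, 0 ≤ τ q) (hx : ContinuousWithinAt x s p)
    {i : Fin n} (ha : 0 < x p i - K.rL i (τ p)) (hb : 0 < K.rU i (τ p) - x p i) :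
    ContinuousWithinAt (fun q => K.vd (τ q) (x q) i) s p := by
  have hmaps : MapsTo τ s (Ici 0) := hτ0
  have hL : ContinuousWithinAt (fun q => K.rL i (τ q)) s p :=
    (hK.continuousOn_rL i (τ p) (hτ0 p hp)).comp hτ hmaps
  have hU : ContinuousWithinAt (fun q => K.rU i (τ q)) s p :=
    (hK.continuousOn_rU i (τ p) (hτ0 p hp)).comp hτ hmaps
  have hxi : ContinuousWithinAt (fun q => x q i) s p :=
    (continuous_apply i).continuousAt.comp_continuousWithinAt hx
  have hw : K.rU i (τ p) - K.rL i (τ p) ≠ 0 := by linarith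
  have hhat : ContinuousWithinAt (fun q => K.xHat (τ q) (x q) i) s p := by
    unfold Controller.xHat
    refine (hxi.sub ((hU.add hL).const_mul _)).div ((hU.sub hL).const_mul _) ?_
    simpa using hw
  obtain ⟨h1, h2⟩ := abs_lt.1 (K.xHat_mem ha hb)
  have h3 : 1 - K.xHat (τ p) (x p) i ≠ 0 := by linarith
  have h4 : 1 + K.xHat (τ p) (x p) i ≠ 0 := by linarith
  have h5 : 1 - K.xHat (τ p) (x p) i ^ 2 ≠ 0 := by
    have : 1 - K.xHat (τ p) (x p) i ^ 2 =
      (1 - K.xHat (τ p) (x p) i) * (1 + K.xHat (τ p) (x p) i) := by ring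
    rw [this]
    exact mul_ne_zero h3 h4
  unfold Controller.vd Controller.xiX Controller.epsX T
  refine (continuousWithinAt_const.mul
    (continuousWithinAt_const.div ((hU.sub hL).mul (continuousWithinAt_const.sub (hhat.pow 2)))
      (mul_ne_zero hw h5))).mul ?_
  exact ((continuousWithinAt_const.add hhat).div (continuousWithinAt_const.sub hhat) h3).log
    (div_ne_zero h4 h3)

theorem continuousWithinAt_evHat (hK : RegularFunnel K A L δ) (hp : p ∈ s)
    (hτ : ContinuousWithinAt τ s p) (hτ0 : ∀ q ∈ s, 0 ≤ τ q) (hx : ContinuousWithinAt x s p)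
    (hv : ContinuousWithinAt v s p)
    {i : Fin n} (ha : 0 < x p i - K.rL i (τ p)) (hb : 0 < K.rU i (τ p) - x p i) :
    ContinuousWithinAt (fun q => K.evHat (τ q) (x q) (v q) i) s p := by
  have hmaps : MapsTo τ s (Ici 0) := hτ0
  have hγ : ContinuousWithinAt (fun q => K.γ i (τ q)) s p :=
    (hK.continuousOn_γ i (τ p) (hτ0 p hp)).comp hτ hmaps
  have hvi : ContinuousWithinAt (fun q => v q i) s p :=
    (continuous_apply i).continuousAt.comp_continuousWithinAt hv
  exact (hvi.sub (hK.continuousWithinAt_vd hp hτ hτ0 hx ha hb)).div hγ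
    (hK.δ_pos.trans_le (hK.le_γ i _ (hτ0 p hp))).ne'

theorem continuousWithinAt_u (hK : RegularFunnel K A L δ) (hp : p ∈ s)
    (hτ : ContinuousWithinAt τ s p) (hτ0 : ∀ q ∈ s, 0 ≤ τ q) (hx : ContinuousWithinAt x s p)
    (hv : ContinuousWithinAt v s p) {w θ : ℝ} (hw : 0 < w) (hθ : 0 < θ)
    (h : K.InMargin w θ (τ p) (x p) (v p)) :
    ContinuousWithinAt (fun q => K.u (τ q) (x q) (v q)) s p := by
  refine continuousWithinAt_pi.2 fun i => ?_
  have hmaps : MapsTo τ s (Ici 0) := hτ0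
  have hγ : ContinuousWithinAt (fun q => K.γ i (τ q)) s p :=
    (hK.continuousOn_γ i (τ p) (hτ0 p hp)).comp hτ hmaps
  have hγ0 := (hK.δ_pos.trans_le (hK.le_γ i _ (hτ0 p hp))).ne'
  have hhat := hK.continuousWithinAt_evHat hp hτ hτ0 hx hv (hw.trans_le (h i).1.1)
    (hw.trans_le (h i).1.2)
  obtain ⟨h1, h2⟩ := abs_le.1 (h i).2
  have h3 : 1 - K.evHat (τ p) (x p) (v p) i ≠ 0 := by linarith
  have h4 : 1 + K.evHat (τ p) (x p) (v p) i ≠ 0 := by linarith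
  have h5 : 1 - K.evHat (τ p) (x p) (v p) i ^ 2 ≠ 0 := by
    have : 1 - K.evHat (τ p) (x p) (v p) i ^ 2 =
      (1 - K.evHat (τ p) (x p) (v p) i) * (1 + K.evHat (τ p) (x p) (v p) i) := by ring
    rw [this]
    exact mul_ne_zero h3 h4
  unfold Controller.u Controller.xiV Controller.epsV T
  refine (continuousWithinAt_const.mul
    (continuousWithinAt_const.div (hγ.mul (continuousWithinAt_const.sub (hhat.pow 2)))
      (mul_ne_zero hγ0 h5))).mul ?_
  exact ((continuousWithinAt_const.add hhat).div (continuousWithinAt_const.sub hhat) h3).log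
    (div_ne_zero h4 h3)

end

end RegularFunnel

/-! ### The truncated closed loop -/

/-- The position, moved to the distance `w` from the funnel boundaries where it is closer. -/
def Controller.xClamp (K : Controller n) (w t : ℝ) (x : Fin n → ℝ) (i : Fin n) : ℝ :=
  max (K.rL i t + w) (min (K.rU i t - w) (x i))

/-- The velocity, moved to the relative distance `θ` from the boundaries of the velocity funnel
around the reference velocity at the clamped position. -/
def Controller.vClamp (K : Controller n) (w θ t : ℝ) (x v : Fin n → ℝ) (i : Fin n) : ℝ :=
  K.vd t (K.xClamp w t x) i +
    K.γ i t * max (-(1 - θ)) (min (1 - θ) (K.evHat t (K.xClamp w t x) v i))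

/-- The closed-loop vector field, evaluated at the clamped state. It is bounded and continuous in
the state, and agrees with the closed loop on `Controller.InMargin w θ`. -/
def truncatedField (S : ELSystem n) (K : Controller n) (w θ t : ℝ)
    (z : (Fin n → ℝ) × (Fin n → ℝ)) : (Fin n → ℝ) × (Fin n → ℝ) :=
  (K.vClamp w θ t z.1 z.2, closedLoopAccel S K t (K.xClamp w t z.1) (K.vClamp w θ t z.1 z.2))

theorem RegularFunnel.inMargin_clamp (hK : RegularFunnel K A L δ) {w θ t : ℝ} (hw : 2 * w ≤ δ)
    (hθ : θ ≤ 1) (ht : 0 ≤ t) (x v : Fin n → ℝ) :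
    K.InMargin w θ t (K.xClamp w t x) (K.vClamp w θ t x v) := by
  intro i
  have hgap := hK.le_gap i t ht
  have hγ := hK.δ_pos.trans_le (hK.le_γ i t ht)
  refine ⟨⟨?_, ?_⟩, ?_⟩
  · have : K.rL i t + w ≤ K.xClamp w t x i := le_max_left _ _
    linarith
  · have : K.xClamp w t x i ≤ K.rU i t - w := max_le (by linarith) (min_le_left _ _)
    linarith
  · have : K.evHat t (K.xClamp w t x) (K.vClamp w θ t x v) i =
        max (-(1 - θ)) (min (1 - θ) (K.evHat t (K.xClamp w t x) v i)) := by
      rw [Controller.evHat, Controller.ev, Controller.vClamp, add_sub_cancel_left,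
        mul_div_cancel_left₀ _ hγ.ne']
    rw [this, abs_le]
    exact ⟨le_max_left _ _, max_le (by linarith) (min_le_left _ _)⟩

theorem Controller.InMargin.xClamp_eq {w θ t : ℝ} {x v : Fin n → ℝ} (h : K.InMargin w θ t x v) :
    K.xClamp w t x = x := by
  funext i
  have h1 := (h i).1
  rw [Controller.xClamp, min_eq_right (by linarith), max_eq_right (by linarith)]

theorem RegularFunnel.vClamp_eq (hK : RegularFunnel K A L δ) {w θ t : ℝ} (ht : 0 ≤ t)
    {x v : Fin n → ℝ} (h : K.InMargin w θ t x v) : K.vClamp w θ t x v = v := by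
  funext i
  have h1 := abs_le.1 (h i).2
  rw [Controller.vClamp, h.xClamp_eq, min_eq_right h1.2, max_eq_right h1.1, mul_comm,
    ← ev_eq_evHat_mul hK ht, Controller.ev]
  ring

theorem RegularFunnel.truncatedField_eq (hK : RegularFunnel K A L δ) (S : ELSystem n) {w θ t : ℝ}
    (ht : 0 ≤ t) {x v : Fin n → ℝ} (h : K.InMargin w θ t x v) :
    truncatedField S K w θ t (x, v) = (v, closedLoopAccel S K t x v) := by
  simp only [truncatedField, h.xClamp_eq, hK.vClamp_eq ht h]

theorem RegularFunnel.exists_truncatedField_bound (hK : RegularFunnel K A L δ) (S : ELSystem n)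
    {w θ : ℝ} (hw0 : 0 < w) (hw : 2 * w ≤ δ) (hθ0 : 0 < θ) (hθ : θ ≤ 1) :
    ∃ B, 0 ≤ B ∧ ∀ t, 0 ≤ t → ∀ z, ‖truncatedField S K w θ t z‖ ≤ B := by
  obtain ⟨B, hB, h⟩ := hK.exists_bounds S hw0 hθ0
  refine ⟨B, hB, fun t ht z => ?_⟩
  obtain ⟨-, h1, -, -, -, -, -, -, -, -, -, h2⟩ :=
    h t ht _ _ (hK.inMargin_clamp hw hθ ht z.1 z.2)
  exact max_le h1 h2

/-- The truncated field, with the disturbance as an independent argument, and with time prolonged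
to the left by the constant `0`. -/
def frozenField (S : ELSystem n) (K : Controller n) (w θ : ℝ)
    (p : ℝ × ((Fin n → ℝ) × (Fin n → ℝ)) × (Fin n → ℝ)) : (Fin n → ℝ) × (Fin n → ℝ) :=
  (K.vClamp w θ (max p.1 0) p.2.1.1 p.2.1.2,
    S.response (K.xClamp w (max p.1 0) p.2.1.1) (K.vClamp w θ (max p.1 0) p.2.1.1 p.2.1.2)
      (K.u (max p.1 0) (K.xClamp w (max p.1 0) p.2.1.1)
        (K.vClamp w θ (max p.1 0) p.2.1.1 p.2.1.2) + p.2.2))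

theorem truncatedField_eq_frozenField (S : ELSystem n) {w θ t : ℝ} (ht : 0 ≤ t)
    (z : (Fin n → ℝ) × (Fin n → ℝ)) :
    truncatedField S K w θ t z = frozenField S K w θ (t, z, S.d t) := by
  simp only [truncatedField, frozenField, max_eq_left ht, closedLoopAccel]

section

variable {X : Type*} [TopologicalSpace X] {τ : X → ℝ} {x v : X → Fin n → ℝ} {w θ : ℝ}

theorem RegularFunnel.continuous_xClamp (hK : RegularFunnel K A L δ) (hτ : Continuous τ)
    (hτ0 : ∀ q, 0 ≤ τ q) (hx : Continuous x) : Continuous fun q => K.xClamp w (τ q) (x q) := by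
  refine continuous_pi fun i => ?_
  unfold Controller.xClamp
  have hL : Continuous fun q => K.rL i (τ q) := (hK.continuousOn_rL i).comp_continuous hτ hτ0
  have hU : Continuous fun q => K.rU i (τ q) := (hK.continuousOn_rU i).comp_continuous hτ hτ0
  exact (hL.add continuous_const).max ((hU.sub continuous_const).min ((continuous_apply i).comp hx))

theorem RegularFunnel.continuous_vClamp (hK : RegularFunnel K A L δ) (hτ : Continuous τ)
    (hτ0 : ∀ q, 0 ≤ τ q) (hx : Continuous x) (hv : Continuous v) (hw0 : 0 < w) (hw : 2 * w ≤ δ)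
    (hθ : θ ≤ 1) : Continuous fun q => K.vClamp w θ (τ q) (x q) (v q) := by
  refine continuous_pi fun i => ?_
  unfold Controller.vClamp
  have hm := fun q => hK.inMargin_clamp hw hθ (hτ0 q) (x q) (v q)
  have hxc : Continuous fun q => K.xClamp w (τ q) (x q) := hK.continuous_xClamp hτ hτ0 hx
  have hγ : Continuous fun q => K.γ i (τ q) := (hK.continuousOn_γ i).comp_continuous hτ hτ0
  have hvd : Continuous fun q => K.vd (τ q) (K.xClamp w (τ q) (x q)) i :=
    continuous_iff_continuousAt.2 fun p => (continuousWithinAt_univ _ _).1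
      (hK.continuousWithinAt_vd (mem_univ p) hτ.continuousWithinAt (fun q _ => hτ0 q)
        hxc.continuousWithinAt (hw0.trans_le (hm p i).1.1) (hw0.trans_le (hm p i).1.2))
  have hev : Continuous fun q => K.evHat (τ q) (K.xClamp w (τ q) (x q)) (v q) i :=
    continuous_iff_continuousAt.2 fun p => (continuousWithinAt_univ _ _).1
      (hK.continuousWithinAt_evHat (mem_univ p) hτ.continuousWithinAt (fun q _ => hτ0 q)
        hxc.continuousWithinAt hv.continuousWithinAt (hw0.trans_le (hm p i).1.1)
        (hw0.trans_le (hm p i).1.2))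
  exact hvd.add (hγ.mul (continuous_const.max (continuous_const.min hev)))

theorem RegularFunnel.continuous_u_clamp (hK : RegularFunnel K A L δ) (hτ : Continuous τ)
    (hτ0 : ∀ q, 0 ≤ τ q) (hx : Continuous x) (hv : Continuous v) (hw0 : 0 < w) (hw : 2 * w ≤ δ)
    (hθ0 : 0 < θ) (hθ : θ ≤ 1) :
    Continuous fun q => K.u (τ q) (K.xClamp w (τ q) (x q)) (K.vClamp w θ (τ q) (x q) (v q)) :=
  continuous_iff_continuousAt.2 fun p => (continuousWithinAt_univ _ _).1
    (hK.continuousWithinAt_u (mem_univ p) hτ.continuousWithinAt (fun q _ => hτ0 q)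
      (hK.continuous_xClamp hτ hτ0 hx).continuousWithinAt
      (hK.continuous_vClamp hτ hτ0 hx hv hw0 hw hθ).continuousWithinAt hw0 hθ0
      (hK.inMargin_clamp hw hθ (hτ0 p) (x p) (v p)))

end

theorem RegularFunnel.continuous_frozenField (hK : RegularFunnel K A L δ) (S : ELSystem n)
    {w θ : ℝ} (hw0 : 0 < w) (hw : 2 * w ≤ δ) (hθ0 : 0 < θ) (hθ : θ ≤ 1) :
    Continuous (frozenField S K w θ) := by
  have ht : Continuous fun p : ℝ × ((Fin n → ℝ) × (Fin n → ℝ)) × (Fin n → ℝ) => max p.1 0 :=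
    continuous_fst.max continuous_const
  have ht0 : ∀ p : ℝ × ((Fin n → ℝ) × (Fin n → ℝ)) × (Fin n → ℝ), 0 ≤ max p.1 0 :=
    fun p => le_max_right _ _
  have hx : Continuous fun p : ℝ × ((Fin n → ℝ) × (Fin n → ℝ)) × (Fin n → ℝ) => p.2.1.1 :=
    continuous_snd.fst.fst
  have hv : Continuous fun p : ℝ × ((Fin n → ℝ) × (Fin n → ℝ)) × (Fin n → ℝ) => p.2.1.2 :=
    continuous_snd.fst.snd
  have hxc := hK.continuous_xClamp (w := w) ht ht0 hx
  have hvc := hK.continuous_vClamp ht ht0 hx hv hw0 hw hθ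
  have huc := hK.continuous_u_clamp ht ht0 hx hv hw0 hw hθ0 hθ
  have hf := huc.add continuous_snd.snd
  have hr := S.continuous_response.comp (hxc.prodMk (hvc.prodMk hf))
  exact hvc.prodMk hr

/-! ### Regularity of the disturbance -/

/-- The discontinuities of the disturbance. -/
def ELSystem.jumps (S : ELSystem n) : Set ℝ := {t | 0 ≤ t ∧ ¬ ContinuousWithinAt S.d (Ici 0) t}

theorem ELSystem.countable_jumps (S : ELSystem n) : S.jumps.Countable := by
  have h : S.jumps ⊆ ⋃ k : ℕ, {t : ℝ | t ∈ Icc 0 (k : ℝ) ∧ ¬ ContinuousWithinAt S.d (Ici 0) t} := by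
    rintro t ⟨ht, hd⟩
    obtain ⟨k, hk⟩ := exists_nat_ge t
    exact mem_iUnion.2 ⟨k, ⟨ht, hk⟩, hd⟩
  exact (countable_iUnion fun k : ℕ => (S.piecewiseContinuous_d.1 k).countable).mono h

theorem ELSystem.aestronglyMeasurable_d (S : ELSystem n) :
    AEStronglyMeasurable S.d (volume.restrict (Ici 0)) := by
  have hc : ContinuousOn S.d (Ici 0 \ S.jumps) := by
    intro t ht
    have : ContinuousWithinAt S.d (Ici 0) t := by
      by_contra h
      exact ht.2 ⟨ht.1, h⟩
    exact this.mono sdiff_subset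
  have hm : MeasurableSet (Ici (0 : ℝ) \ S.jumps) :=
    measurableSet_Ici.diff S.countable_jumps.measurableSet
  have h := hc.aestronglyMeasurable (μ := volume) hm
  rwa [Measure.restrict_congr_set
    (sdiff_null_ae_eq_self (S.countable_jumps.measure_zero volume))] at h

/-- The truncated field along a measurable path is measurable in time. -/
theorem RegularFunnel.aestronglyMeasurable_truncatedField (hK : RegularFunnel K A L δ)
    (S : ELSystem n) {w θ : ℝ} (hw0 : 0 < w) (hw : 2 * w ≤ δ) (hθ0 : 0 < θ) (hθ : θ ≤ 1)
    {z : ℝ → (Fin n → ℝ) × (Fin n → ℝ)} {I : Set ℝ} (hI : I ⊆ Ici 0) (hIm : MeasurableSet I)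
    (hz : AEStronglyMeasurable z (volume.restrict I)) :
    AEStronglyMeasurable (fun t => truncatedField S K w θ t (z t)) (volume.restrict I) := by
  have h1 : AEStronglyMeasurable (fun t => frozenField S K w θ (t, z t, S.d t))
      (volume.restrict I) :=
    (hK.continuous_frozenField S hw0 hw hθ0 hθ).comp_aestronglyMeasurable
      (aestronglyMeasurable_id.prodMk
        (hz.prodMk (S.aestronglyMeasurable_d.mono_measure (Measure.restrict_mono_set _ hI))))
  refine h1.congr ?_
  filter_upwards [ae_restrict_mem hIm] with t ht
  exact (truncatedField_eq_frozenField S (hI ht) _).symm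

/-! ### Trajectories of the closed loop -/

/-- The closed-loop equations at one time `t`, the equation of motion being solved for the
acceleration. -/
def ObeysLoopAt (S : ELSystem n) (K : Controller n) (x v : ℝ → Fin n → ℝ) (t : ℝ) : Prop :=
  HasDerivWithinAt x (v t) (Ici 0) t ∧ (ContinuousWithinAt S.d (Ici 0) t →
    HasDerivWithinAt v (closedLoopAccel S K t (x t) (v t)) (Ici 0) t)

theorem RegularFunnel.intervalIntegrable_truncatedField (hK : RegularFunnel K A L δ)
    (S : ELSystem n) {w θ : ℝ} (hw0 : 0 < w) (hw : 2 * w ≤ δ) (hθ0 : 0 < θ) (hθ : θ ≤ 1)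
    {z : ℝ → (Fin n → ℝ) × (Fin n → ℝ)} {a b : ℝ} (ha : 0 ≤ a) (hab : a ≤ b)
    (hz : AEStronglyMeasurable z (volume.restrict (Ioc a b))) :
    IntervalIntegrable (fun t => truncatedField S K w θ t (z t)) volume a b := by
  obtain ⟨B, hB, h⟩ := hK.exists_truncatedField_bound S hw0 hw hθ0 hθ
  have hI : Ioc a b ⊆ Ici 0 := fun t ht => ha.trans ht.1.le
  refine (intervalIntegrable_const (c := B)).mono_fun ?_ ?_
  · rw [uIoc_of_le hab]
    exact hK.aestronglyMeasurable_truncatedField S hw0 hw hθ0 hθ hI measurableSet_Ioc hz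
  · rw [uIoc_of_le hab]
    filter_upwards [ae_restrict_mem measurableSet_Ioc] with t ht
    exact (h t (hI ht) _).trans (le_abs_self B)

/-- Inside the margins, trajectories satisfy the integral equation of the truncated field. -/
theorem RegularFunnel.integral_equation (hK : RegularFunnel K A L δ)
    {S : ELSystem n} {w θ : ℝ} (hw0 : 0 < w) (hw : 2 * w ≤ δ) (hθ0 : 0 < θ) (hθ : θ ≤ 1)
    {x v : ℝ → Fin n → ℝ} {a b : ℝ} (ha : 0 ≤ a) (hab : a ≤ b)
    (hv : ContinuousOn v (Icc a b)) (hobey : ∀ t ∈ Icc a b, ObeysLoopAt S K x v t)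
    (hmargin : ∀ t ∈ Icc a b, K.InMargin w θ t (x t) (v t)) :
    ∫ t in a..b, truncatedField S K w θ t (x t, v t) = (x b, v b) - (x a, v a) := by
  have hsub : Icc a b ⊆ Ici 0 := fun t ht => ha.trans ht.1
  have hx : ContinuousOn x (Icc a b) := fun t ht =>
    (hobey t ht).1.continuousWithinAt.mono hsub
  have hy : ContinuousOn (fun t => (x t, v t)) (Icc a b) := hx.prodMk hv
  refine integral_eq_of_hasDerivAt_off_countable_of_le _ _ hab S.countable_jumps hy ?_ ?_
  · rintro t ⟨ht, hjump⟩
    have ht' : t ∈ Icc a b := ⟨ht.1.le, ht.2.le⟩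
    have ht0 : 0 < t := ha.trans_lt ht.1
    rw [hK.truncatedField_eq S ht0.le (hmargin t ht')]
    have hd : ContinuousWithinAt S.d (Ici 0) t := by
      by_contra hd
      exact hjump ⟨ht0.le, hd⟩
    exact ((hobey t ht').1.hasDerivAt (Ici_mem_nhds ht0)).prodMk
      (((hobey t ht').2 hd).hasDerivAt (Ici_mem_nhds ht0))
  · exact hK.intervalIntegrable_truncatedField S hw0 hw hθ0 hθ ha hab
      ((hy.mono Ioc_subset_Icc_self).aestronglyMeasurable measurableSet_Ioc)

/-! ### The position stays away from the funnel boundaries -/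

theorem distanceFeedback_swap (a b : ℝ) : distanceFeedback a b = -distanceFeedback b a := by
  unfold distanceFeedback
  ring

/-- Near the upper boundary the feedback is as strong as desired. -/
theorem le_distanceFeedback {a b N : ℝ} (hA : 0 < A) (hδ : 0 < δ) (hN : 0 ≤ N) (hb0 : 0 < b)
    (hb : b ≤ δ / 2 * Real.exp (-N)) (hab : δ ≤ a + b) (hab' : a + b ≤ 2 * A) :
    2 / A * N ≤ distanceFeedback a b := by
  have hexp : Real.exp (-N) ≤ 1 := Real.exp_le_one_iff.2 (by linarith)
  have hb2 : b ≤ δ / 2 := hb.trans (by nlinarith)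
  have ha : δ / 2 ≤ a := by linarith
  have ha0 : 0 < a := by linarith
  have h1 : N ≤ Real.log a - Real.log b := by
    have h2 : Real.log b ≤ Real.log (δ / 2) + -N := by
      rw [← Real.log_exp (-N), ← Real.log_mul (by positivity) (Real.exp_ne_zero _)]
      exact Real.log_le_log hb0 hb
    have h3 : Real.log (δ / 2) ≤ Real.log a := Real.log_le_log (by positivity) ha
    linarith
  -- the harmonic mean of the distances is at most their arithmetic mean, hence at most `A`
  have h4 : 2 / A ≤ 1 / a + 1 / b := by
    rw [div_add_div _ _ ha0.ne' hb0.ne', div_le_div_iff₀ hA (by positivity)]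
    nlinarith [sq_nonneg (a - b)]
  unfold distanceFeedback
  exact mul_le_mul h4 h1 hN (by positivity)

/-- The mean value inequality with one-sided bounds on the derivative. -/
theorem sub_bounds_of_deriv_bounds {f f' : ℝ → ℝ} {a b : ℝ} (hab : a ≤ b)
    (hc : ContinuousOn f (Icc a b)) (hd : ∀ r ∈ Ioo a b, HasDerivAt f (f' r) r) :
    (∀ C, (∀ r ∈ Ioo a b, f' r ≤ C) → f b - f a ≤ C * (b - a)) ∧
      ∀ C, (∀ r ∈ Ioo a b, C ≤ f' r) → C * (b - a) ≤ f b - f a := by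
  have hdiff : DifferentiableOn ℝ f (interior (Icc a b)) := fun r hr => by
    rw [interior_Icc] at hr
    exact (hd r hr).differentiableAt.differentiableWithinAt
  refine ⟨fun C hC => (convex_Icc a b).image_sub_le_mul_sub_of_deriv_le hc hdiff (fun r hr => ?_)
      a ⟨le_rfl, hab⟩ b ⟨hab, le_rfl⟩ hab,
    fun C hC => (convex_Icc a b).mul_sub_le_image_sub_of_le_deriv hc hdiff (fun r hr => ?_)
      a ⟨le_rfl, hab⟩ b ⟨hab, le_rfl⟩ hab⟩
  all_goals
    rw [interior_Icc] at hr
    rw [(hd r hr).deriv]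
    exact hC r hr

/-- Near the boundaries of the position funnel the reference velocity points inwards and exceeds
the sum of the admissible velocity error and the speed of the boundaries. The position therefore
keeps a distance that does not depend on the trajectory. -/
theorem RegularFunnel.exists_position_margin (hK : RegularFunnel K A L δ) {r : ℝ} (hr : 0 < r) :
    ∃ w, 0 < w ∧ 2 * w ≤ δ ∧ w ≤ r ∧ ∀ (s : ℝ) (x v : ℝ → Fin n → ℝ),
      (∀ t ∈ Icc 0 s, HasDerivWithinAt x (v t) (Ici 0) t) →
      (∀ t ∈ Icc 0 s, ∀ i, (0 < x t i - K.rL i t ∧ 0 < K.rU i t - x t i) ∧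
        |K.ev t (x t) (v t) i| ≤ A) →
      (∀ i, w ≤ x 0 i - K.rL i 0 ∧ w ≤ K.rU i 0 - x 0 i) →
      ∀ t ∈ Icc 0 s, ∀ i, w ≤ x t i - K.rL i t ∧ w ≤ K.rU i t - x t i := by
  have hA := hK.A_pos
  have hL := hK.L_nonneg
  have hδ := hK.δ_pos
  have hkx := hK.kx_pos
  set N := (A + L) * A / (2 * K.kx) with hN
  have hN0 : 0 ≤ N := by positivity
  have hkN : K.kx * (2 / A * N) = A + L := by rw [hN]; field_simp
  set w := min r (δ / 2 * Real.exp (-N)) with hw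
  have hexp : Real.exp (-N) ≤ 1 := Real.exp_le_one_iff.2 (by linarith)
  have hw1 : w ≤ δ / 2 * Real.exp (-N) := min_le_right _ _
  refine ⟨w, by positivity, by nlinarith, min_le_left _ _, fun s x v hx hin h0 t ht i => ?_⟩
  have hxc : ContinuousOn (fun t => x t i) (Icc 0 s) := fun t ht =>
    (continuous_apply i).continuousAt.comp_continuousWithinAt
      ((hx t ht).continuousWithinAt.mono Icc_subset_Ici_self)
  have hIci : Icc 0 s ⊆ Ici 0 := Icc_subset_Ici_self
  have hLc := (hK.continuousOn_rL i).mono hIci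
  have hUc := (hK.continuousOn_rU i).mono hIci
  have hvel : ∀ r ∈ Icc 0 s, v r i = K.vd r (x r) i + K.ev r (x r) (v r) i := fun r _ => by
    unfold Controller.ev
    ring
  have hder : ∀ r, 0 < r → r ∈ Icc 0 s → HasDerivAt (fun t => x t i) (v r i) r := fun r hr hrs =>
    (hasDerivAt_pi.1 ((hx r hrs).hasDerivAt (Ici_mem_nhds hr))) i
  have hwidth : ∀ r ∈ Icc 0 s, δ ≤ K.rU i r - K.rL i r ∧ K.rU i r - K.rL i r ≤ 2 * A := by
    intro r hr
    have h1 := abs_le.1 (hK.abs_rL_le i r hr.1)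
    have h2 := abs_le.1 (hK.abs_rU_le i r hr.1)
    exact ⟨hK.le_gap i r hr.1, by linarith⟩
  constructor
  · refine le_of_nondecreasing_below (hxc.sub hLc) (h0 i).1 ?_ t ht
    intro σ q hσ hσq hqs hlow
    have hsub : Icc σ q ⊆ Icc 0 s := Icc_subset_Icc hσ hqs
    have hspeed : ∀ r ∈ Icc σ q, L ≤ v r i := by
      intro r hr
      obtain ⟨⟨ha, hb⟩, hev⟩ := hin r (hsub hr) i
      obtain ⟨h1, h2⟩ := hwidth r (hsub hr)
      have h3 := le_distanceFeedback hA hδ hN0 ha ((hlow r hr).trans hw1)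
        (a := K.rU i r - x r i) (by linarith) (by linarith)
      rw [hvel r (hsub hr), K.vd_eq ha hb, distanceFeedback_swap]
      have h4 := mul_le_mul_of_nonneg_left h3 hkx.le
      have h5 := (abs_le.1 hev).1
      linarith
    have h1 : L * (q - σ) ≤ x q i - x σ i :=
      (sub_bounds_of_deriv_bounds hσq (hxc.mono hsub) fun r hr =>
        hder r (hσ.trans_lt hr.1) (hsub ⟨hr.1.le, hr.2.le⟩)).2 _
          fun r hr => hspeed r ⟨hr.1.le, hr.2.le⟩
    have h2 := (abs_le.1 (hK.lip_rL i q σ (hσ.trans hσq) hσ)).2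
    rw [abs_of_nonneg (by linarith : 0 ≤ q - σ)] at h2
    simp only [Pi.sub_apply]
    linarith
  · refine le_of_nondecreasing_below (hUc.sub hxc) (h0 i).2 ?_ t ht
    intro σ q hσ hσq hqs hlow
    have hsub : Icc σ q ⊆ Icc 0 s := Icc_subset_Icc hσ hqs
    have hspeed : ∀ r ∈ Icc σ q, v r i ≤ -L := by
      intro r hr
      obtain ⟨⟨ha, hb⟩, hev⟩ := hin r (hsub hr) i
      obtain ⟨h1, h2⟩ := hwidth r (hsub hr)
      have h3 := le_distanceFeedback hA hδ hN0 hb ((hlow r hr).trans hw1)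
        (a := x r i - K.rL i r) (by linarith) (by linarith)
      rw [hvel r (hsub hr), K.vd_eq ha hb]
      have h4 := mul_le_mul_of_nonneg_left h3 hkx.le
      have h5 := (abs_le.1 hev).2
      linarith
    have h1 : x q i - x σ i ≤ -L * (q - σ) :=
      (sub_bounds_of_deriv_bounds hσq (hxc.mono hsub) fun r hr =>
        hder r (hσ.trans_lt hr.1) (hsub ⟨hr.1.le, hr.2.le⟩)).1 _
          fun r hr => hspeed r ⟨hr.1.le, hr.2.le⟩
    have h2 := (abs_le.1 (hK.lip_rU i q σ (hσ.trans hσq) hσ)).1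
    rw [abs_of_nonneg (by linarith : 0 ≤ q - σ)] at h2
    simp only [Pi.sub_apply]
    linarith

/-! ### The velocity error stays away from the boundary of its funnel -/

theorem hasDerivAt_T {z : ℝ} (h : |z| < 1) : HasDerivAt T (2 / (1 - z ^ 2)) z := by
  obtain ⟨h1, h2⟩ := abs_lt.1 h
  have h3 : 1 - z ≠ 0 := by linarith
  have h4 : 1 + z ≠ 0 := by linarith
  have hd := ((((hasDerivAt_id z).const_add 1).div ((hasDerivAt_id z).const_sub 1) h3).log
    (div_ne_zero h4 h3))
  have h5 : 1 - z ^ 2 ≠ 0 := by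
    have : 1 - z ^ 2 = (1 - z) * (1 + z) := by ring
    rw [this]
    exact mul_ne_zero h3 h4
  refine HasDerivAt.congr_deriv hd ?_
  simp only [id]
  have h6 : 1 - z ^ 2 = (1 - z) * (1 + z) := by ring
  rw [h6]
  simp only [Pi.div_apply]
  field_simp
  ring

theorem exists_lipschitz_half_T_sq {θ : ℝ} (hθ : 0 < θ) :
    ∃ C : NNReal, LipschitzOnWith C (fun z => 1 / 2 * T z ^ 2) (Icc (-(1 - θ)) (1 - θ)) := by
  refine ContDiffOn.exists_lipschitzOnWith (n := 1) ?_ one_ne_zero (convex_Icc _ _) isCompact_Icc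
  have hT : ContDiffOn ℝ 1 T (Icc (-(1 - θ)) (1 - θ)) := by
    unfold T
    have h1 : ∀ z ∈ Icc (-(1 - θ)) (1 - θ), 1 - z ≠ 0 := fun z hz => by linarith [hz.2]
    have h2 : ∀ z ∈ Icc (-(1 - θ)) (1 - θ), 1 + z ≠ 0 := fun z hz => by linarith [hz.1]
    exact ((contDiffOn_const.add contDiffOn_id).div (contDiffOn_const.sub contDiffOn_id) h1).log
      fun z hz => div_ne_zero (h2 z hz) (h1 z hz)
  exact contDiffOn_const.mul (hT.pow 2)

theorem exists_lipschitz_distanceFeedback {w : ℝ} (hw : 0 < w) (r : ℝ) :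
    ∃ C : ℝ, 0 ≤ C ∧ ∀ a b a' b' : ℝ, a ∈ Icc w r → b ∈ Icc w r → a' ∈ Icc w r → b' ∈ Icc w r →
      |distanceFeedback a b - distanceFeedback a' b'| ≤ C * max |a - a'| |b - b'| := by
  obtain ⟨C, hC⟩ : ∃ C : NNReal, LipschitzOnWith C
      (fun p : ℝ × ℝ => distanceFeedback p.1 p.2) (Icc w r ×ˢ Icc w r) := by
    refine ContDiffOn.exists_lipschitzOnWith (n := 1) ?_ one_ne_zero
      ((convex_Icc _ _).prod (convex_Icc _ _)) (isCompact_Icc.prod isCompact_Icc)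
    have h1 : ∀ p ∈ Icc w r ×ˢ Icc w r, p.1 ≠ 0 := fun p hp => (hw.trans_le hp.1.1).ne'
    have h2 : ∀ p ∈ Icc w r ×ˢ Icc w r, p.2 ≠ 0 := fun p hp => (hw.trans_le hp.2.1).ne'
    unfold distanceFeedback
    exact ((contDiffOn_const.div contDiffOn_fst h1).add
      (contDiffOn_const.div contDiffOn_snd h2)).mul
        ((contDiffOn_fst.log h1).sub (contDiffOn_snd.log h2))
  refine ⟨C, C.2, fun a b a' b' ha hb ha' hb' => ?_⟩
  have := hC.dist_le_mul (a, b) ⟨ha, hb⟩ (a', b') ⟨ha', hb'⟩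
  simpa only [Prod.dist_eq, Real.dist_eq] using this

/-- On bounded sets of positions, the inverse inertia matrices are uniformly positive definite. -/
theorem ELSystem.exists_coercive_inv (S : ELSystem n) (r : ℝ) :
    ∃ lam, 0 < lam ∧ ∀ x s : Fin n → ℝ, ‖x‖ ≤ r → lam * ‖s‖ ^ 2 ≤ s ⬝ᵥ (S.M x)⁻¹.mulVec s := by
  set Q : Set ((Fin n → ℝ) × (Fin n → ℝ)) := Metric.closedBall 0 r ×ˢ Metric.sphere 0 1 with hQ
  have hQc : IsCompact Q := (isCompact_closedBall _ _).prod (isCompact_sphere _ _)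
  have hf : Continuous fun p : (Fin n → ℝ) × (Fin n → ℝ) => p.2 ⬝ᵥ (S.M p.1)⁻¹.mulVec p.2 :=
    continuous_snd.dotProduct
      ((S.continuous_inv.comp continuous_fst).matrix_mulVec continuous_snd)
  obtain ⟨lam, hlam, h⟩ : ∃ lam, 0 < lam ∧ ∀ p ∈ Q, lam ≤ p.2 ⬝ᵥ (S.M p.1)⁻¹.mulVec p.2 := by
    rcases Q.eq_empty_or_nonempty with he | hne
    · exact ⟨1, one_pos, fun p hp => by simp [he] at hp⟩
    · obtain ⟨p, hp, hmin⟩ := hQc.exists_isMinOn hne hf.continuousOn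
      refine ⟨p.2 ⬝ᵥ (S.M p.1)⁻¹.mulVec p.2, ?_, fun q hq => hmin hq⟩
      have hp2 : p.2 ≠ 0 := by
        have : ‖p.2‖ = 1 := by simpa using hp.2
        rintro h0
        simp [h0] at this
      simpa using (S.posDef_M p.1).inv.dotProduct_mulVec_pos hp2
  refine ⟨lam, hlam, fun x s hx => ?_⟩
  rcases eq_or_ne s 0 with rfl | hs
  · simp
  have hs' : 0 < ‖s‖ := norm_pos_iff.2 hs
  have h1 := h (x, ‖s‖⁻¹ • s) ⟨by simpa using hx, by
    rw [mem_sphere_zero_iff_norm, norm_smul, norm_inv, norm_norm, inv_mul_cancel₀ hs'.ne']⟩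
  simp only [Matrix.mulVec_smul, smul_dotProduct, dotProduct_smul, smul_eq_mul] at h1
  have h2 := mul_le_mul_of_nonneg_left h1 (sq_nonneg ‖s‖)
  have h3 : ‖s‖ ^ 2 * (‖s‖⁻¹ * (‖s‖⁻¹ * s ⬝ᵥ (S.M x)⁻¹.mulVec s)) =
      s ⬝ᵥ (S.M x)⁻¹.mulVec s := by field_simp
  linarith

/-- The Lyapunov function of the velocity loop, `½ ‖ε_v‖²`. -/
def velocityEnergy (K : Controller n) (t : ℝ) (x v : Fin n → ℝ) : ℝ :=
  ∑ i, 1 / 2 * K.epsV t x v i ^ 2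

theorem abs_epsV_le_of_velocityEnergy_le {t V : ℝ} {x v : Fin n → ℝ}
    (h : velocityEnergy K t x v ≤ V) (i : Fin n) : |K.epsV t x v i| ≤ Real.sqrt (2 * V) := by
  have h1 : 1 / 2 * K.epsV t x v i ^ 2 ≤ velocityEnergy K t x v :=
    Finset.single_le_sum (f := fun i => 1 / 2 * K.epsV t x v i ^ 2)
      (fun j _ => by positivity) (Finset.mem_univ i)
  exact Real.abs_le_sqrt (by linarith)

/-- The Lyapunov estimate, as a statement of linear algebra: with `s = ξ_v ε_v`, the term
`-k sᵀ M⁻¹ s` outweighs the bounded perturbation `b` for large `s`. -/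
theorem lyapunov_rate_nonpos {M : Matrix (Fin n) (Fin n) ℝ} {lam k c : ℝ} {s b : Fin n → ℝ}
    (hk : 0 < k) (hM : lam * ‖s‖ ^ 2 ≤ s ⬝ᵥ M.mulVec s) (hb : ∀ i, |b i| ≤ c)
    (hs : n * c ≤ k * lam * ‖s‖) :
    ∑ i, s i * (M.mulVec (-k • s) i + b i) ≤ 0 := by
  have h1 : ∑ i, s i * (M.mulVec (-k • s) i + b i) =
      -k * (s ⬝ᵥ M.mulVec s) + ∑ i, s i * b i := by
    simp only [mul_add, Finset.sum_add_distrib, Matrix.mulVec_smul, Pi.smul_apply, smul_eq_mul,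
      dotProduct, Finset.mul_sum]
    congr 1
    exact Finset.sum_congr rfl fun i _ => by ring
  have h2 : ∑ i, s i * b i ≤ n * (‖s‖ * c) := by
    calc ∑ i, s i * b i ≤ ∑ _i : Fin n, ‖s‖ * c := Finset.sum_le_sum fun i _ =>
          (le_abs_self _).trans (by
            rw [abs_mul]
            exact mul_le_mul (norm_le_pi_norm s i) (hb i) (abs_nonneg _) (norm_nonneg _))
      _ = n * (‖s‖ * c) := by simp
  rw [h1]
  have h3 := mul_le_mul_of_nonneg_left hM hk.le
  have h4 := mul_le_mul_of_nonneg_right hs (norm_nonneg s)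
  nlinarith

/-- Position and velocity are bounded where the position keeps a distance from its funnel
boundaries, uniformly in the distance of the velocity error from its own. -/
theorem RegularFunnel.exists_state_bound (hK : RegularFunnel K A L δ) {w : ℝ} (hw : 0 < w) :
    ∃ B, 0 ≤ B ∧ ∀ t, 0 ≤ t → ∀ (x v : Fin n → ℝ), K.InMargin w 0 t x v →
      ‖x‖ ≤ B ∧ ‖v‖ ≤ B := by
  obtain ⟨B, hB, h⟩ := hK.exists_position_bounds hw
  have hA := hK.A_pos
  refine ⟨B + A, by positivity, fun t ht x v hm => ⟨?_, ?_⟩⟩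
  · refine norm_le_of_forall_abs_le (by positivity) fun i => ?_
    have := (h t ht x i (hm i).1.1 (hm i).1.2).1
    linarith
  · refine norm_le_of_forall_abs_le (by positivity) fun i => ?_
    have h1 := (h t ht x i (hm i).1.1 (hm i).1.2).2.2.2.2
    have h2 := hK.abs_ev_le ht ((hm i).2.trans (by linarith))
    have : v i = K.vd t x i + K.ev t x v i := by unfold Controller.ev; ring
    rw [this]
    exact (abs_add_le _ _).trans (add_le_add h1 h2)

/-- The reference velocity is Lipschitz in time along trajectories. It need not be differentiable,
as the planned funnel is not. -/
theorem RegularFunnel.exists_lipschitz_vd (hK : RegularFunnel K A L δ) {w : ℝ} (hw : 0 < w) :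
    ∃ C, 0 ≤ C ∧ ∀ (s : ℝ) (x v : ℝ → Fin n → ℝ),
      (∀ t ∈ Icc 0 s, HasDerivWithinAt x (v t) (Ici 0) t) →
      (∀ t ∈ Icc 0 s, K.InMargin w 0 t (x t) (v t)) →
      ∀ i, ∀ t ∈ Icc 0 s, ∀ q ∈ Icc 0 s, |K.vd t (x t) i - K.vd q (x q) i| ≤ C * |t - q| := by
  obtain ⟨B, hB, hbound⟩ := hK.exists_state_bound hw
  obtain ⟨C, hC, hlip⟩ := exists_lipschitz_distanceFeedback hw (2 * A)
  have hL := hK.L_nonneg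
  have hkx := hK.kx_pos
  refine ⟨K.kx * (C * (B + L)), by positivity, fun s x v hx hm i t ht q hq => ?_⟩
  have hmem : ∀ r ∈ Icc 0 s, x r i - K.rL i r ∈ Icc w (2 * A) ∧
      K.rU i r - x r i ∈ Icc w (2 * A) := by
    intro r hr
    obtain ⟨h1, h2⟩ := (hm r hr i).1
    have h3 := abs_le.1 (hK.abs_rL_le i r hr.1)
    have h4 := abs_le.1 (hK.abs_rU_le i r hr.1)
    exact ⟨⟨h1, by linarith⟩, h2, by linarith⟩
  have hxlip : |x t i - x q i| ≤ B * |t - q| := by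
    have h1 := (convex_Icc 0 s).norm_image_sub_le_of_norm_hasDerivWithin_le
      (fun r hr => (hx r hr).mono Icc_subset_Ici_self)
      (fun r hr => (hbound r hr.1 _ _ (hm r hr)).2) hq ht
    exact (norm_le_pi_norm (x t - x q) i).trans h1
  have hr := hlip _ _ _ _ (hmem t ht).1 (hmem t ht).2 (hmem q hq).1 (hmem q hq).2
  have h1 : |x t i - K.rL i t - (x q i - K.rL i q)| ≤ (B + L) * |t - q| := by
    rw [sub_sub_sub_comm, add_mul]
    exact (abs_sub _ _).trans (add_le_add hxlip (hK.lip_rL i t q ht.1 hq.1))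
  have h2 : |K.rU i t - x t i - (K.rU i q - x q i)| ≤ (B + L) * |t - q| := by
    rw [sub_sub_sub_comm, add_mul, add_comm]
    exact (abs_sub _ _).trans (add_le_add (hK.lip_rU i t q ht.1 hq.1) hxlip)
  have h3 := hr.trans (mul_le_mul_of_nonneg_left (max_le h1 h2) hC)
  rw [K.vd_eq (hw.trans_le (hmem t ht).1.1) (hw.trans_le (hmem t ht).2.1),
    K.vd_eq (hw.trans_le (hmem q hq).1.1) (hw.trans_le (hmem q hq).2.1), ← mul_sub, abs_mul,
    abs_neg, abs_of_pos hkx]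
  calc _ ≤ K.kx * (C * ((B + L) * |t - q|)) := mul_le_mul_of_nonneg_left h3 hkx.le
    _ = _ := by ring

/-- Along a trajectory inside the margins, the velocity is Lipschitz in time. -/
theorem RegularFunnel.exists_lipschitz_velocity (hK : RegularFunnel K A L δ) (S : ELSystem n)
    {w θ : ℝ} (hw0 : 0 < w) (hw : 2 * w ≤ δ) (hθ0 : 0 < θ) (hθ : θ ≤ 1) :
    ∃ B, 0 ≤ B ∧ ∀ (s : ℝ) (x v : ℝ → Fin n → ℝ), ContinuousOn v (Icc 0 s) →
      (∀ t ∈ Icc 0 s, ObeysLoopAt S K x v t) →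
      (∀ t ∈ Icc 0 s, K.InMargin w θ t (x t) (v t)) →
      ∀ t ∈ Icc 0 s, ∀ q ∈ Icc 0 s, ‖v t - v q‖ ≤ B * |t - q| := by
  obtain ⟨B, hB, h⟩ := hK.exists_truncatedField_bound S hw0 hw hθ0 hθ
  refine ⟨B, hB, fun s x v hv hobey hm t ht q hq => ?_⟩
  wlog hqt : q ≤ t generalizing t q
  · rw [norm_sub_rev, abs_sub_comm]
    exact this q hq t ht (le_of_not_ge hqt)
  have hsub : Icc q t ⊆ Icc 0 s := Icc_subset_Icc hq.1 ht.2
  have h1 := hK.integral_equation (S := S) (x := x) hw0 hw hθ0 hθ hq.1 hqt (hv.mono hsub)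
    (fun r hr => hobey r (hsub hr)) (fun r hr => hm r (hsub hr))
  have h2 : ‖∫ r in q..t, truncatedField S K w θ r (x r, v r)‖ ≤ B * |t - q| :=
    intervalIntegral.norm_integral_le_of_norm_le_const fun r hr =>
      h r (hq.1.trans (uIoc_of_le hqt ▸ hr).1.le) _
  rw [h1] at h2
  exact (norm_snd_le ((x t, v t) - (x q, v q))).trans h2

theorem RegularFunnel.lipschitz_evHat (hK : RegularFunnel K A L δ) {x v : ℝ → Fin n → ℝ}
    {i : Fin n} {B C t q : ℝ} (ht : 0 ≤ t) (hq : 0 ≤ q) (hv : ‖v t - v q‖ ≤ B * |t - q|)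
    (hvd : |K.vd t (x t) i - K.vd q (x q) i| ≤ C * |t - q|)
    (h : |K.evHat q (x q) (v q) i| ≤ 1) :
    |K.evHat t (x t) (v t) i - K.evHat q (x q) (v q) i| ≤ (B + C + L) / δ * |t - q| := by
  have hγ := hK.δ_pos.trans_le (hK.le_γ i t ht)
  have h1 : K.evHat t (x t) (v t) i - K.evHat q (x q) (v q) i =
      ((v t i - v q i) - (K.vd t (x t) i - K.vd q (x q) i) -
        K.evHat q (x q) (v q) i * (K.γ i t - K.γ i q)) / K.γ i t := by
    have h2 := ev_eq_evHat_mul hK hq (x q) (v q) i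
    rw [eq_div_iff hγ.ne', sub_mul, ← ev_eq_evHat_mul hK ht, mul_sub, ← h2]
    unfold Controller.ev
    ring
  have h3 : |v t i - v q i| ≤ B * |t - q| := (norm_le_pi_norm (v t - v q) i).trans hv
  have h4 : |K.evHat q (x q) (v q) i * (K.γ i t - K.γ i q)| ≤ L * |t - q| := by
    rw [abs_mul]
    have := mul_le_mul h (hK.lip_γ i t q ht hq) (abs_nonneg _) zero_le_one
    linarith
  have h5 : |(v t i - v q i) - (K.vd t (x t) i - K.vd q (x q) i) -
        K.evHat q (x q) (v q) i * (K.γ i t - K.γ i q)| ≤ (B + C + L) * |t - q| :=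
    (abs_sub _ _).trans ((add_le_add_left (abs_sub _ _) _).trans (by linarith))
  rw [h1, abs_div, abs_of_pos hγ, div_mul_eq_mul_div]
  exact div_le_div₀ ((abs_nonneg _).trans h5) h5 hK.δ_pos (hK.le_γ i t ht)

/-- The time derivative of the velocity energy, at a time at which all ingredients are
differentiable. -/
theorem RegularFunnel.hasDerivAt_velocityEnergy (hK : RegularFunnel K A L δ) {x v : ℝ → Fin n → ℝ}
    {t : ℝ} {a p g : Fin n → ℝ} (ht : 0 ≤ t) (hv : HasDerivAt v a t)
    (hvd : ∀ i, HasDerivAt (fun r => K.vd r (x r) i) (p i) t)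
    (hγ : ∀ i, HasDerivAt (K.γ i) (g i) t) (h : ∀ i, |K.evHat t (x t) (v t) i| < 1) :
    HasDerivAt (fun r => velocityEnergy K r (x r) (v r))
      (∑ i, K.xiV t (x t) (v t) i * K.epsV t (x t) (v t) i *
        (a i - p i - K.evHat t (x t) (v t) i * g i)) t := by
  unfold velocityEnergy
  refine HasDerivAt.fun_sum fun i _ => ?_
  have hγ0 := (hK.δ_pos.trans_le (hK.le_γ i t ht)).ne'
  have h1 : HasDerivAt (fun r => K.evHat r (x r) (v r) i)
      ((a i - p i - K.evHat t (x t) (v t) i * g i) / K.γ i t) t := by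
    refine ((((hasDerivAt_pi.1 hv) i).sub (hvd i)).div (hγ i) hγ0).congr_deriv ?_
    rw [Controller.evHat, Controller.ev]
    simp only [Pi.sub_apply]
    field_simp
  have h2 : HasDerivAt (fun r => K.epsV r (x r) (v r) i) _ t := (hasDerivAt_T (h i)).comp t h1
  refine ((h2.pow 2).const_mul (1 / 2)).congr_deriv ?_
  have h3 : 1 - K.evHat t (x t) (v t) i ^ 2 ≠ 0 := by
    have := (sq_lt_one_iff_abs_lt_one _).2 (h i)
    linarith
  simp only [Controller.xiV]
  field_simp
  ring

/-- Above a level that depends neither on the trajectory nor on the distance of the velocity error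
from its funnel boundary, the velocity energy does not increase. -/
theorem RegularFunnel.exists_energy_level (hK : RegularFunnel K A L δ) (S : ELSystem n) {w : ℝ}
    (hw0 : 0 < w) (hw : 2 * w ≤ δ) :
    ∃ V, ∀ θ, 0 < θ → θ ≤ 1 → ∀ (s : ℝ) (x v : ℝ → Fin n → ℝ), ContinuousOn v (Icc 0 s) →
      (∀ t ∈ Icc 0 s, ObeysLoopAt S K x v t) →
      (∀ t ∈ Icc 0 s, K.InMargin w θ t (x t) (v t)) →
      ContinuousOn (fun t => velocityEnergy K t (x t) (v t)) (Icc 0 s) ∧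
      ∀ σ t, 0 ≤ σ → σ ≤ t → t ≤ s → (∀ r ∈ Icc σ t, V ≤ velocityEnergy K r (x r) (v r)) →
        velocityEnergy K t (x t) (v t) ≤ velocityEnergy K σ (x σ) (v σ) := by
  obtain ⟨B, hB, hstate⟩ := hK.exists_state_bound hw0
  obtain ⟨C, hC, hvdlip⟩ := hK.exists_lipschitz_vd hw0
  obtain ⟨D, hD⟩ := S.bounded_d
  obtain ⟨R, hR, hresp⟩ := S.exists_response_bound (max B |D|)
  obtain ⟨lam, hlam, hcoer⟩ := S.exists_coercive_inv B
  have hA := hK.A_pos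
  have hL := hK.L_nonneg
  have hkv := hK.kv_pos
  have hδ := hK.δ_pos
  set c := R + C + L with hc
  -- `|ε_v| ≥ N` makes `|ξ_v ε_v|` so large that the feedback dominates
  set N := A / 2 * (n * c / (K.kv * lam)) with hN
  have hN0 : 0 ≤ N := by positivity
  refine ⟨n * (1 / 2 * N ^ 2) + 1, fun θ hθ0 hθ s x v hv hobey hm => ?_⟩
  obtain ⟨Bv, hBv, hvlip⟩ := hK.exists_lipschitz_velocity S hw0 hw hθ0 hθ
  obtain ⟨CT, hCT⟩ := exists_lipschitz_half_T_sq hθ0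
  have hm0 : ∀ t ∈ Icc 0 s, K.InMargin w 0 t (x t) (v t) := fun t ht =>
    (hm t ht).mono le_rfl hθ0.le
  have hvd := hvdlip s x v (fun t ht => (hobey t ht).1) hm0
  have hvl := hvlip s x v hv hobey hm
  have hehat : ∀ t ∈ Icc 0 s, ∀ i, |K.evHat t (x t) (v t) i| ≤ 1 := fun t ht i =>
    (hm t ht i).2.trans (by linarith)
  -- the energy is Lipschitz in time
  obtain ⟨CE, hCE0, hCE⟩ : ∃ CE : ℝ, 0 ≤ CE ∧ ∀ t ∈ Icc 0 s, ∀ q ∈ Icc 0 s,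
      |velocityEnergy K t (x t) (v t) - velocityEnergy K q (x q) (v q)| ≤ CE * |t - q| := by
    refine ⟨n * (CT * ((Bv + C + L) / δ)), by positivity, fun t ht q hq => ?_⟩
    unfold velocityEnergy
    rw [← Finset.sum_sub_distrib]
    refine (Finset.abs_sum_le_sum_abs _ _).trans ?_
    have : ∀ i ∈ Finset.univ, |1 / 2 * K.epsV t (x t) (v t) i ^ 2 -
        1 / 2 * K.epsV q (x q) (v q) i ^ 2| ≤ CT * ((Bv + C + L) / δ * |t - q|) := by
      intro i _
      have h1 := hCT.dist_le_mul _ (abs_le.1 (hm t ht i).2) _ (abs_le.1 (hm q hq i).2)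
      rw [Real.dist_eq, Real.dist_eq] at h1
      exact h1.trans (mul_le_mul_of_nonneg_left (hK.lipschitz_evHat ht.1 hq.1 (hvl t ht q hq)
        (hvd i t ht q hq) (hehat q hq i)) CT.2)
    refine (Finset.sum_le_sum this).trans (le_of_eq ?_)
    simp only [Finset.sum_const, Finset.card_univ, Fintype.card_fin, nsmul_eq_mul]
    ring
  have hElip : LipschitzOnWith CE.toNNReal (fun t => velocityEnergy K t (x t) (v t)) (Icc 0 s) :=
    LipschitzOnWith.of_dist_le_mul fun t ht q hq => by
      rw [Real.dist_eq, Real.dist_eq, Real.coe_toNNReal _ hCE0]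
      exact hCE t ht q hq
  refine ⟨hElip.continuousOn, fun σ t hσ hσt hts hhigh => ?_⟩
  have hsub : Icc σ t ⊆ Icc 0 s := Icc_subset_Icc hσ hts
  have hsub' : uIcc σ t ⊆ Icc 0 s := by rwa [uIcc_of_le hσt]
  refine le_of_ae_deriv_nonpos hσt (hElip.mono hsub').absolutelyContinuousOnInterval ?_
  have hdvd : ∀ i, ∀ᵐ r, r ∈ uIcc σ t → DifferentiableAt ℝ (fun r => K.vd r (x r) i) r :=
    fun i => by
      refine (LipschitzOnWith.absolutelyContinuousOnInterval (K := C.toNNReal)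
        (LipschitzOnWith.of_dist_le_mul fun r hr q hq => ?_)).ae_differentiableAt
      rw [Real.dist_eq, Real.dist_eq, Real.coe_toNNReal _ hC]
      exact hvd i r (hsub' hr) q (hsub' hq)
  have hdγ : ∀ i, ∀ᵐ r, r ∈ uIcc σ t → DifferentiableAt ℝ (K.γ i) r := fun i => by
    refine (LipschitzOnWith.absolutelyContinuousOnInterval (K := L.toNNReal)
      (LipschitzOnWith.of_dist_le_mul fun r hr q hq => ?_)).ae_differentiableAt
    rw [Real.dist_eq, Real.dist_eq, Real.coe_toNNReal _ hL]
    exact hK.lip_γ i r q (hsub' hr).1 (hsub' hq).1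
  have hjump : ∀ᵐ r, r ∉ S.jumps := S.countable_jumps.ae_notMem volume
  have hends : ∀ᵐ r : ℝ, r ∉ ({σ, t} : Set ℝ) := (toFinite {σ, t}).countable.ae_notMem volume
  filter_upwards [eventually_countable_forall.2 hdvd, eventually_countable_forall.2 hdγ, hjump,
    hends] with r h1 h2 h3 h4 hr
  have hru : r ∈ uIcc σ t := by rwa [uIcc_of_le hσt]
  have hrs := hsub hr
  have hσr : σ < r := lt_of_le_of_ne hr.1 fun h => h4 (by simp [h])
  have hrt : r < t := lt_of_le_of_ne hr.2 fun h => h4 (by simp [h])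
  have hr0 : 0 < r := hσ.trans_lt hσr
  have hdr : ContinuousWithinAt S.d (Ici 0) r := by
    by_contra hd
    exact h3 ⟨hr0.le, hd⟩
  have hnear : ∀ᶠ q in 𝓝 r, q ∈ Icc 0 s :=
    mem_of_superset (Icc_mem_nhds hσr hrt) hsub
  have hp : ∀ i, |deriv (fun r => K.vd r (x r) i) r| ≤ C := fun i =>
    norm_deriv_le_of_lip' (f := fun r => K.vd r (x r) i) hC
      (hnear.mono fun q hq => hvd i q hq r hrs)
  have hg : ∀ i, |deriv (K.γ i) r| ≤ L := fun i =>
    norm_deriv_le_of_lip' (f := K.γ i) hL (hnear.mono fun q hq => hK.lip_γ i q r hq.1 hr0.le)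
  have hder := hK.hasDerivAt_velocityEnergy hr0.le
    (((hobey r hrs).2 hdr).hasDerivAt (Ici_mem_nhds hr0)) (fun i => (h1 i hru).hasDerivAt)
    (fun i => (h2 i hru).hasDerivAt) fun i => (hm r hrs i).2.trans_lt (by linarith)
  rw [hder.deriv]
  set sv : Fin n → ℝ := fun i => K.xiV r (x r) (v r) i * K.epsV r (x r) (v r) i with hsv
  set ρ := S.response (x r) (v r) (S.d r) with hρ
  obtain ⟨hxB, hvB⟩ := hstate r hr0.le _ _ (hm0 r hrs)
  have hacc : closedLoopAccel S K r (x r) (v r) =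
      (S.M (x r))⁻¹.mulVec (-K.kv • sv) + ρ := by
    have hu : K.u r (x r) (v r) = -K.kv • sv := by
      funext i
      simp only [Controller.u, hsv, Pi.smul_apply, smul_eq_mul]
      ring
    rw [closedLoopAccel, hρ, hu]
    unfold ELSystem.response
    rw [← Matrix.mulVec_add]
    congr 1
    abel
  have hsum := lyapunov_rate_nonpos (s := sv) (c := c)
    (b := fun i => ρ i - deriv (fun r => K.vd r (x r) i) r -
      K.evHat r (x r) (v r) i * deriv (K.γ i) r) hkv (hcoer (x r) sv hxB) ?_ ?_
  · refine le_trans (le_of_eq (Finset.sum_congr rfl fun i _ => ?_)) hsum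
    rw [hacc]
    simp only [Pi.add_apply, hsv]
    ring
  · intro i
    have hρi : |ρ i| ≤ R := (norm_le_pi_norm ρ i).trans (hresp _ _ _ (hxB.trans (le_max_left _ _))
      (hvB.trans (le_max_left _ _))
      (((hD r hr0.le).trans (le_abs_self D)).trans (le_max_right _ _)))
    have h5 : |K.evHat r (x r) (v r) i * deriv (K.γ i) r| ≤ L := by
      rw [abs_mul]
      have := mul_le_mul (hehat r hrs i) (hg i) (abs_nonneg _) zero_le_one
      linarith
    exact (abs_sub _ _).trans (add_le_add ((abs_sub _ _).trans (add_le_add hρi (hp i))) h5)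
  · obtain ⟨i, hi⟩ : ∃ i, N ≤ |K.epsV r (x r) (v r) i| := by
      by_contra hcon
      push Not at hcon
      have h5 : velocityEnergy K r (x r) (v r) ≤ ∑ _i : Fin n, 1 / 2 * N ^ 2 :=
        Finset.sum_le_sum fun i _ => by
          have := sq_le_sq' (by linarith [abs_nonneg (K.epsV r (x r) (v r) i), hcon i])
            (hcon i).le
          rw [sq_abs] at this
          linarith
      rw [Finset.sum_const, Finset.card_univ, Fintype.card_fin, nsmul_eq_mul] at h5
      have := hhigh r hr
      linarith
    have hγA := (le_abs_self _).trans (hK.abs_γ_le i r hr0.le)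
    have hγ0 := hδ.trans_le (hK.le_γ i r hr0.le)
    have hxi : 2 / A ≤ K.xiV r (x r) (v r) i := by
      have h5 := (sq_lt_one_iff_abs_lt_one _).2 ((hm r hrs i).2.trans_lt (by linarith))
      have h6 := sq_nonneg (K.evHat r (x r) (v r) i)
      unfold Controller.xiV
      exact div_le_div_of_nonneg_left zero_le_two (mul_pos hγ0 (by linarith)) (by nlinarith)
    have hs1 : 2 / A * N ≤ ‖sv‖ := by
      refine le_trans ?_ (norm_le_pi_norm sv i)
      rw [Real.norm_eq_abs, hsv]
      simp only [abs_mul]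
      exact mul_le_mul (hxi.trans (le_abs_self _)) hi hN0 (abs_nonneg _)
    have h7 : 2 / A * N = n * c / (K.kv * lam) := by rw [hN]; field_simp
    rw [h7, div_le_iff₀ (by positivity)] at hs1
    linarith

/-! ### A priori bounds -/

/-- For given initial data there are margins, independent of the trajectory, which trajectories
satisfy as long as they satisfy the halved margins. -/
theorem RegularFunnel.exists_margins (hK : RegularFunnel K A L δ) (S : ELSystem n)
    {x₀ v₀ : Fin n → ℝ} (hx₀ : ∀ i, 0 < x₀ i - K.rL i 0 ∧ 0 < K.rU i 0 - x₀ i)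
    (hv₀ : ∀ i, |K.evHat 0 x₀ v₀ i| < 1) :
    ∃ w θ, 0 < w ∧ 2 * w ≤ δ ∧ 0 < θ ∧ θ ≤ 1 ∧ K.InMargin w θ 0 x₀ v₀ ∧
      ∀ (s : ℝ) (x v : ℝ → Fin n → ℝ), x 0 = x₀ → v 0 = v₀ → ContinuousOn v (Icc 0 s) →
        (∀ t ∈ Icc 0 s, ObeysLoopAt S K x v t) →
        (∀ t ∈ Icc 0 s, K.InMargin (w / 2) (θ / 2) t (x t) (v t)) →
        ∀ t ∈ Icc 0 s, K.InMargin w θ t (x t) (v t) := by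
  obtain ⟨r, hr, hr₀⟩ : ∃ r, 0 < r ∧ ∀ i, r ≤ x₀ i - K.rL i 0 ∧ r ≤ K.rU i 0 - x₀ i := by
    obtain ⟨m, hm⟩ := Finite.exists_le fun i => (x₀ i - K.rL i 0)⁻¹
    obtain ⟨m', hm'⟩ := Finite.exists_le fun i => (K.rU i 0 - x₀ i)⁻¹
    have hpos : 0 < max (max m m') 1 := lt_max_of_lt_right one_pos
    refine ⟨(max (max m m') 1)⁻¹, inv_pos.2 hpos, fun i => ⟨?_, ?_⟩⟩
    · exact inv_le_of_inv_le₀ (hx₀ i).1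
        ((hm i).trans ((le_max_left _ _).trans (le_max_left _ _)))
    · exact inv_le_of_inv_le₀ (hx₀ i).2
        ((hm' i).trans ((le_max_right _ _).trans (le_max_left _ _)))
  obtain ⟨w, hw0, hw, hwr, hpos⟩ := hK.exists_position_margin hr
  obtain ⟨V, hV⟩ := hK.exists_energy_level S hw0 hw
  set V₁ := max V (velocityEnergy K 0 x₀ v₀) with hV₁
  set θ := Real.exp (-Real.sqrt (2 * V₁)) with hθ
  have hθ0 : 0 < θ := Real.exp_pos _
  have hθ1 : θ ≤ 1 := Real.exp_le_one_iff.2 (neg_nonpos.2 (Real.sqrt_nonneg _))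
  have hconf : ∀ t (x v : Fin n → ℝ), (∀ i, |K.evHat t x v i| < 1) →
      velocityEnergy K t x v ≤ V₁ → ∀ i, |K.evHat t x v i| ≤ 1 - θ := fun t x v h1 h2 i =>
    abs_le_of_abs_T_le (h1 i) (abs_epsV_le_of_velocityEnergy_le h2 i)
  have hinit : ∀ i, w ≤ x₀ i - K.rL i 0 ∧ w ≤ K.rU i 0 - x₀ i := fun i =>
    ⟨hwr.trans (hr₀ i).1, hwr.trans (hr₀ i).2⟩
  refine ⟨w, θ, hw0, hw, hθ0, hθ1,
    fun i => ⟨hinit i, hconf 0 x₀ v₀ hv₀ (le_max_right _ _) i⟩,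
    fun s x v hx hv hvc hobey hm => ?_⟩
  have hm1 : ∀ t ∈ Icc 0 s, ∀ i, |K.evHat t (x t) (v t) i| < 1 := fun t ht i =>
    (hm t ht i).2.trans_lt (by linarith)
  have hp := hpos s x v (fun t ht => (hobey t ht).1)
    (fun t ht i => ⟨⟨lt_of_lt_of_le (by linarith) (hm t ht i).1.1,
      lt_of_lt_of_le (by linarith) (hm t ht i).1.2⟩, hK.abs_ev_le ht.1 (hm1 t ht i).le⟩)
    (by rw [hx]; exact hinit)
  obtain ⟨hc, hdec⟩ := hV (θ / 2) (by linarith) (by linarith) s x v hvc hobey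
    fun t ht i => ⟨hp t ht i, (hm t ht i).2⟩
  intro t ht i
  have hE : velocityEnergy K t (x t) (v t) ≤ V₁ := by
    have := le_of_nondecreasing_below (m := -V₁) hc.neg
      (by simp only [Pi.neg_apply, hx, hv]; exact neg_le_neg (le_max_right _ _))
      (fun σ q h1 h2 h3 h4 => neg_le_neg (hdec σ q h1 h2 h3 fun r hr =>
        (le_max_left _ _).trans (neg_le_neg_iff.1 (h4 r hr)))) t ht
    exact neg_le_neg_iff.1 this
  exact ⟨hp t ht i, hconf t _ _ (hm1 t ht) hE i⟩

section

variable {x v : ℝ → Fin n → ℝ} {w θ s t : ℝ}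

theorem RegularFunnel.inMargin_of_Ico (hK : RegularFunnel K A L δ) (hw : 0 < w)
    (hx : ContinuousOn x (Icc 0 s)) (hv : ContinuousOn v (Icc 0 s)) (ht : 0 < t) (hts : t ≤ s)
    (h : ∀ r ∈ Ico 0 t, K.InMargin w θ r (x r) (v r)) : K.InMargin w θ t (x t) (v t) := by
  have hmem : t ∈ Icc 0 s := ⟨ht.le, hts⟩
  have hsub : Ico 0 t ⊆ Icc 0 s := fun r hr => ⟨hr.1, hr.2.le.trans hts⟩
  have hIci : Icc 0 s ⊆ Ici 0 := Icc_subset_Ici_self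
  have hcl : t ∈ closure (Ico 0 t) := by
    rw [closure_Ico ht.ne]
    exact ⟨ht.le, le_rfl⟩
  have lim : ∀ {f : ℝ → ℝ} {F : Set ℝ}, ContinuousWithinAt f (Icc 0 s) t → IsClosed F →
      (∀ r ∈ Ico 0 t, f r ∈ F) → f t ∈ F := fun hf hF hr => by
    have := (hf.mono hsub).mem_closure hcl hr
    rwa [hF.closure_eq] at this
  intro i
  have hxi : ContinuousWithinAt (fun r => x r i) (Icc 0 s) t :=
    (continuous_apply i).continuousAt.comp_continuousWithinAt (hx t hmem)
  have hL := ((hK.continuousOn_rL i).mono hIci) t hmem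
  have hU := ((hK.continuousOn_rU i).mono hIci) t hmem
  have ha : w ≤ x t i - K.rL i t := lim (F := Ici w) (hxi.sub hL) isClosed_Ici
    fun r hr => (h r hr i).1.1
  have hb : w ≤ K.rU i t - x t i := lim (F := Ici w) (hU.sub hxi) isClosed_Ici
    fun r hr => (h r hr i).1.2
  have he := hK.continuousWithinAt_evHat (τ := id) hmem continuousWithinAt_id (fun r hr => hr.1)
    (hx t hmem) (hv t hmem) (hw.trans_le ha) (hw.trans_le hb)
  exact ⟨⟨ha, hb⟩, lim (F := Iic (1 - θ)) he.abs isClosed_Iic fun r hr => (h r hr i).2⟩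

theorem RegularFunnel.eventually_inMargin_half (hK : RegularFunnel K A L δ) (hw : 0 < w)
    (hθ : 0 < θ) (hx : ContinuousOn x (Icc 0 s)) (hv : ContinuousOn v (Icc 0 s))
    (ht : t ∈ Icc 0 s) (h : K.InMargin w θ t (x t) (v t)) :
    ∀ᶠ r in 𝓝[Icc 0 s] t, K.InMargin (w / 2) (θ / 2) r (x r) (v r) := by
  have hIci : Icc 0 s ⊆ Ici 0 := Icc_subset_Ici_self
  refine eventually_all.2 fun i => ?_
  have hxi : ContinuousWithinAt (fun r => x r i) (Icc 0 s) t :=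
    (continuous_apply i).continuousAt.comp_continuousWithinAt (hx t ht)
  have hL := ((hK.continuousOn_rL i).mono hIci) t ht
  have hU := ((hK.continuousOn_rU i).mono hIci) t ht
  have he := hK.continuousWithinAt_evHat (τ := id) ht continuousWithinAt_id (fun r hr => hr.1)
    (hx t ht) (hv t ht) (hw.trans_le (h i).1.1) (hw.trans_le (h i).1.2)
  have e1 := (hxi.sub hL).eventually_const_lt (lt_of_lt_of_le (half_lt_self hw) (h i).1.1)
  have e2 := (hU.sub hxi).eventually_const_lt (lt_of_lt_of_le (half_lt_self hw) (h i).1.2)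
  have e3 := he.abs.eventually_lt_const (u := 1 - θ / 2) (lt_of_le_of_lt (h i).2 (by linarith))
  filter_upwards [e1, e2, e3] with r h1 h2 h3
  exact ⟨⟨h1.le, h2.le⟩, h3.le⟩

/-- Continuous induction: a trajectory that obeys the closed loop inside the halved margins never
leaves the margins. -/
theorem RegularFunnel.inMargin_of_step (hK : RegularFunnel K A L δ) {S : ELSystem n} (hw : 0 < w)
    (hθ : 0 < θ) (hx : ContinuousOn x (Icc 0 s)) (hv : ContinuousOn v (Icc 0 s))
    (h0 : K.InMargin w θ 0 (x 0) (v 0))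
    (hobey : ∀ t ∈ Icc 0 s, K.InMargin (w / 2) (θ / 2) t (x t) (v t) → ObeysLoopAt S K x v t)
    (hstep : ∀ q ≤ s, (∀ t ∈ Icc 0 q, ObeysLoopAt S K x v t) →
      (∀ t ∈ Icc 0 q, K.InMargin (w / 2) (θ / 2) t (x t) (v t)) →
      ∀ t ∈ Icc 0 q, K.InMargin w θ t (x t) (v t)) :
    ∀ t ∈ Icc 0 s, K.InMargin w θ t (x t) (v t) := by
  have key : Icc 0 s ⊆ {t | ∀ r ∈ Icc 0 t, K.InMargin w θ r (x r) (v r)} := by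
    refine IsClosed.Icc_subset_of_forall_exists_gt ?_ ?_ ?_
    · refine isClosed_of_closure_subset fun t ht => ?_
      have hts : t ∈ Icc 0 s := by
        have := closure_mono inter_subset_right ht
        rwa [isClosed_Icc.closure_eq] at this
      have hbelow : ∀ r ∈ Ico 0 t, K.InMargin w θ r (x r) (v r) := by
        intro r hr
        obtain ⟨q, hq, hq'⟩ := mem_closure_iff.1 ht (Ioi r) isOpen_Ioi hr.2
        exact hq'.1 r ⟨hr.1, le_of_lt hq⟩
      refine ⟨fun r hr => ?_, hts⟩
      rcases hr.2.lt_or_eq with hrt | rfl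
      · exact hbelow r ⟨hr.1, hrt⟩
      · rcases hr.1.lt_or_eq with hr0 | rfl
        · exact hK.inMargin_of_Ico hw hx hv hr0 hts.2 hbelow
        · exact h0
    · intro r hr
      have : r = 0 := le_antisymm hr.2 hr.1
      rwa [this]
    · rintro t ⟨htm, ht⟩ y hy
      have htm : ∀ r ∈ Icc 0 t, K.InMargin w θ r (x r) (v r) := htm
      have h1 := hK.eventually_inMargin_half hw hθ hx hv ⟨ht.1, ht.2.le⟩ (htm t ⟨ht.1, le_rfl⟩)
      have h2 : ∀ᶠ r in 𝓝[≥] t, r ∈ Icc 0 s → K.InMargin (w / 2) (θ / 2) r (x r) (v r) :=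
        (eventually_nhdsWithin_iff.1 h1).filter_mono nhdsWithin_le_nhds
      obtain ⟨u, hu, hu'⟩ := (mem_nhdsGE_iff_exists_Icc_subset).1 h2
      have htu : t < u := hu
      have hy : t < y := hy
      set q := min (min u y) s
      have htq : t < q := lt_min (lt_min htu hy) ht.2
      have hqs : q ≤ s := min_le_right _ _
      refine ⟨q, ?_, htq, (min_le_left _ _).trans (min_le_right _ _)⟩
      have hhalf : ∀ r ∈ Icc 0 q, K.InMargin (w / 2) (θ / 2) r (x r) (v r) := by
        intro r hr
        rcases le_total r t with hrt | hrt
        · exact (htm r ⟨hr.1, hrt⟩).mono (by linarith) (by linarith)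
        · exact hu' ⟨hrt, hr.2.trans ((min_le_left _ _).trans (min_le_left _ _))⟩
            ⟨hr.1, hr.2.trans hqs⟩
      exact hstep q hqs (fun r hr => hobey r ⟨hr.1, hr.2.trans hqs⟩ (hhalf r hr)) hhalf
  exact fun t ht => key ht t ⟨ht.1, le_rfl⟩

end

/-! ### Existence and extension of solutions -/

/-- The fundamental theorem of calculus on `[0, ∞)`, with a one-sided derivative at zero. -/
theorem hasDerivWithinAt_integral_Ici {E : Type*} [NormedAddCommGroup E] [NormedSpace ℝ E]
    [CompleteSpace E] {f : ℝ → E} {t : ℝ} (ht : 0 ≤ t)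
    (hm : AEStronglyMeasurable f (volume.restrict (Ioi 0))) (hi : IntervalIntegrable f volume 0 t)
    (hc : ContinuousWithinAt f (Ici 0) t) :
    HasDerivWithinAt (fun u => ∫ s in (0 : ℝ)..u, f s) (f t) (Ici 0) t := by
  rcases ht.eq_or_lt with rfl | ht
  · exact intervalIntegral.integral_hasDerivWithinAt_right hi (t := Ioi 0)
      ⟨Ioi 0, self_mem_nhdsWithin, hm⟩ (hc.mono Ioi_subset_Ici_self)
  · exact (intervalIntegral.integral_hasDerivAt_right hi ⟨Ioi 0, Ioi_mem_nhds ht, hm⟩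
      (hc.continuousAt (Ici_mem_nhds ht))).hasDerivWithinAt

section Truncated

variable {S : ELSystem n} {w θ : ℝ}

theorem RegularFunnel.continuous_truncatedField (hK : RegularFunnel K A L δ) (S : ELSystem n)
    (hw0 : 0 < w) (hw : 2 * w ≤ δ) (hθ0 : 0 < θ) (hθ : θ ≤ 1) {t : ℝ} (ht : 0 ≤ t) :
    Continuous (truncatedField S K w θ t) := by
  have h : truncatedField S K w θ t = fun z => frozenField S K w θ (t, z, S.d t) := by
    funext z
    exact truncatedField_eq_frozenField S ht z
  rw [h]
  have h1 : Continuous fun z : (Fin n → ℝ) × (Fin n → ℝ) => (t, z, S.d t) := by fun_prop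
  exact (hK.continuous_frozenField S hw0 hw hθ0 hθ).comp h1

/-- Solutions of the integral equation of the truncated field obey the closed loop wherever the
margins hold. -/
theorem RegularFunnel.obeysLoopAt_of_integral_eq (hK : RegularFunnel K A L δ)
    (hw0 : 0 < w) (hw : 2 * w ≤ δ) (hθ0 : 0 < θ) (hθ : θ ≤ 1)
    {Y : ℝ → (Fin n → ℝ) × (Fin n → ℝ)} {y₀ : (Fin n → ℝ) × (Fin n → ℝ)} (hY : Continuous Y)
    (hint : ∀ t, 0 ≤ t → Y t = y₀ + ∫ s in (0 : ℝ)..t, truncatedField S K w θ s (Y s))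
    {t : ℝ} (ht : 0 ≤ t) (hm : K.InMargin w θ t (Y t).1 (Y t).2) :
    ObeysLoopAt S K (fun s => (Y s).1) (fun s => (Y s).2) t := by
  set f := fun s => truncatedField S K w θ s (Y s) with hf
  have hft : f t = ((Y t).2, closedLoopAccel S K t (Y t).1 (Y t).2) :=
    hK.truncatedField_eq S ht hm
  have hfm : AEStronglyMeasurable f (volume.restrict (Ioi 0)) :=
    hK.aestronglyMeasurable_truncatedField S hw0 hw hθ0 hθ Ioi_subset_Ici_self measurableSet_Ioi
      hY.aestronglyMeasurable
  have hfi : ∀ u, 0 ≤ u → IntervalIntegrable f volume 0 u := fun u hu =>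
    hK.intervalIntegrable_truncatedField S hw0 hw hθ0 hθ le_rfl hu hY.aestronglyMeasurable
  have hfrozen := hK.continuous_frozenField S hw0 hw hθ0 hθ
  constructor
  · -- the first component does not involve the disturbance, and is continuous at all times
    have h1 : HasDerivWithinAt (fun u => ∫ s in (0 : ℝ)..u, (f s).1) (f t).1 (Ici 0) t := by
      refine hasDerivWithinAt_integral_Ici ht hfm.fst ⟨(hfi t ht).1.fst, (hfi t ht).2.fst⟩ ?_
      have h2 : Continuous fun s => (frozenField S K w θ (s, Y s, 0)).1 :=
        continuous_fst.comp (hfrozen.comp (by fun_prop))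
      refine (h2.continuousWithinAt (s := Ici 0) (x := t)).congr (fun s hs => ?_) ?_
      · simp only [hf, truncatedField_eq_frozenField S (mem_Ici.1 hs), frozenField]
      · simp only [hf, truncatedField_eq_frozenField S ht, frozenField]
    rw [hft] at h1
    refine (h1.const_add y₀.1).congr (fun u hu => ?_) ?_
    all_goals
      rw [hint _ (by assumption), Prod.fst_add]
      congr 1
      exact ((ContinuousLinearMap.fst ℝ (Fin n → ℝ) (Fin n → ℝ)).intervalIntegral_comp_comm
        (hfi _ (by assumption))).symm
  · intro hd
    have h1 : HasDerivWithinAt (fun u => ∫ s in (0 : ℝ)..u, f s) (f t) (Ici 0) t := by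
      refine hasDerivWithinAt_integral_Ici ht hfm (hfi t ht) ?_
      have h2 : ContinuousWithinAt (fun s => frozenField S K w θ (s, Y s, S.d s)) (Ici 0) t :=
        hfrozen.continuousAt.comp_continuousWithinAt
          (continuousWithinAt_id.prodMk (hY.continuousWithinAt.prodMk hd))
      exact h2.congr (fun s hs => truncatedField_eq_frozenField S (mem_Ici.1 hs) _)
        (truncatedField_eq_frozenField S ht _)
    have h2 := (h1.const_add y₀).congr (f₁ := Y) (fun u hu => hint u hu) (hint t ht)
    have h3 := h2.snd
    rwa [hft] at h3

/-- Integral solutions of the truncated system on `[0, τ)` extend to `[0, ∞)`. The extension is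
obtained from Peano's theorem for a field that, before the time `τ`, ignores the state and follows
the given solution instead. -/
theorem RegularFunnel.exists_truncated_extension (hK : RegularFunnel K A L δ) (S : ELSystem n)
    (hw0 : 0 < w) (hw : 2 * w ≤ δ) (hθ0 : 0 < θ) (hθ : θ ≤ 1) (τ : ℝ)
    {y : ℝ → (Fin n → ℝ) × (Fin n → ℝ)} {y₀ : (Fin n → ℝ) × (Fin n → ℝ)}
    (hy : ContinuousOn y (Ico 0 τ))
    (hint : ∀ t ∈ Ico 0 τ, y t = y₀ + ∫ s in (0 : ℝ)..t, truncatedField S K w θ s (y s)) :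
    ∃ Y : ℝ → (Fin n → ℝ) × (Fin n → ℝ), Continuous Y ∧
      (∀ t, 0 ≤ t → Y t = y₀ + ∫ s in (0 : ℝ)..t, truncatedField S K w θ s (Y s)) ∧
      ∀ t ∈ Ico 0 τ, Y t = y t := by
  classical
  obtain ⟨B, hB, hbound⟩ := hK.exists_truncatedField_bound S hw0 hw hθ0 hθ
  set F : ℝ → (Fin n → ℝ) × (Fin n → ℝ) → (Fin n → ℝ) × (Fin n → ℝ) := fun s z =>
    (Ici (0 : ℝ)).indicator
      (fun s => truncatedField S K w θ s ((Iio τ).piecewise y (fun _ => z) s)) s with hF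
  have hFbound : ∀ s z, ‖F s z‖ ≤ B := by
    intro s z
    simp only [hF]
    by_cases hs : s ∈ Ici (0 : ℝ)
    · rw [indicator_of_mem hs]
      exact hbound s hs _
    · rw [indicator_of_notMem hs, norm_zero]
      exact hB
  have hFcont : ∀ s, Continuous (F s) := by
    intro s
    simp only [hF]
    by_cases hs : s ∈ Ici (0 : ℝ)
    · simp only [indicator_of_mem hs]
      by_cases hsτ : s ∈ Iio τ
      · simp only [piecewise_eq_of_mem _ _ _ hsτ]
        exact continuous_const
      · simp only [piecewise_eq_of_notMem _ _ _ hsτ]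
        exact hK.continuous_truncatedField S hw0 hw hθ0 hθ hs
    · simp only [indicator_of_notMem hs]
      exact continuous_const
  have hFmeas : ∀ z : ℝ → (Fin n → ℝ) × (Fin n → ℝ), StronglyMeasurable z →
      AEStronglyMeasurable (fun s => F s (z s)) volume := by
    intro z hz
    have hpath : AEStronglyMeasurable ((Iio τ).piecewise y z) (volume.restrict (Ici 0)) := by
      refine AEStronglyMeasurable.piecewise measurableSet_Iio ?_ hz.aestronglyMeasurable
      rw [Measure.restrict_restrict measurableSet_Iio, inter_comm, Ici_inter_Iio]
      exact hy.aestronglyMeasurable measurableSet_Ico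
    have h := hK.aestronglyMeasurable_truncatedField S hw0 hw hθ0 hθ subset_rfl measurableSet_Ici
      hpath
    rw [← aestronglyMeasurable_indicator_iff measurableSet_Ici] at h
    exact h
  obtain ⟨Y, hYlip, hY⟩ := exists_integral_solution F hFbound hFcont hFmeas y₀
  have hagree : ∀ t ∈ Ico 0 τ, Y t = y t := by
    intro t ht
    rw [hY t ht.1, hint t ht]
    congr 1
    refine intervalIntegral.integral_congr fun s hs => ?_
    rw [uIcc_of_le ht.1] at hs
    simp only [hF]
    rw [indicator_of_mem (mem_Ici.2 hs.1),
      piecewise_eq_of_mem _ _ _ (mem_Iio.2 (hs.2.trans_lt ht.2))]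
  refine ⟨Y, hYlip.continuous, fun t ht => ?_, hagree⟩
  rw [hY t ht]
  congr 1
  refine intervalIntegral.integral_congr fun s hs => ?_
  rw [uIcc_of_le ht] at hs
  simp only [hF]
  rw [indicator_of_mem (mem_Ici.2 hs.1)]
  rcases lt_or_ge s τ with hsτ | hsτ
  · rw [piecewise_eq_of_mem _ _ _ (mem_Iio.2 hsτ), hagree s ⟨hs.1, hsτ⟩]
  · rw [piecewise_eq_of_notMem _ _ _ (by simpa using hsτ)]

end Truncated

theorem timeInterval_top : timeInterval ⊤ = Ici 0 := by
  ext t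
  simp [timeInterval]

theorem Icc_subset_timeInterval {τ : EReal} {t : ℝ} (ht : t ∈ timeInterval τ) :
    Icc 0 t ⊆ timeInterval τ := fun _ hr =>
  ⟨hr.1, (EReal.coe_le_coe_iff.2 hr.2).trans_lt ht.2⟩

theorem IsClosedLoopSolution.obeysLoopAt {S : ELSystem n} {x₀ v₀ : Fin n → ℝ} {τ : EReal}
    {x v : ℝ → Fin n → ℝ} (h : IsClosedLoopSolution S K x₀ v₀ τ x v) {t : ℝ}
    (ht : t ∈ timeInterval τ) : ObeysLoopAt S K x v t := by
  refine ⟨h.deriv_x t ht, fun hd => ?_⟩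
  obtain ⟨a, ha, heq⟩ := h.motion t ht hd
  rwa [(motion_iff S K t _ _ a).1 heq] at ha

theorem isClosedLoopSolution_of_obeysLoopAt {S : ELSystem n} {x₀ v₀ : Fin n → ℝ} {τ : EReal}
    {x v : ℝ → Fin n → ℝ} (hx : x 0 = x₀) (hv : v 0 = v₀)
    (hc : ContinuousOn v (timeInterval τ)) (h : ∀ t ∈ timeInterval τ, ObeysLoopAt S K x v t) :
    IsClosedLoopSolution S K x₀ v₀ τ x v where
  init_x := hx
  init_v := hv
  continuousOn_v := hc
  deriv_x t ht := (h t ht).1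
  motion t ht hd := ⟨_, (h t ht).2 hd, (motion_iff S K t _ _ _).2 rfl⟩

/-- The margins that hold along all solutions, on whatever time interval, together with the
extension of solutions from `[0, τ)` to `[0, ∞)`; for `τ = 0` the latter is existence. -/
theorem RegularFunnel.exists_margins_and_extension (hK : RegularFunnel K A L δ) (S : ELSystem n)
    {x₀ v₀ : Fin n → ℝ} (hx₀ : ∀ i, 0 < x₀ i - K.rL i 0 ∧ 0 < K.rU i 0 - x₀ i)
    (hv₀ : ∀ i, |K.evHat 0 x₀ v₀ i| < 1) :
    ∃ w θ, 0 < w ∧ 0 < θ ∧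
      (∀ (τ : EReal) (x v : ℝ → Fin n → ℝ), IsClosedLoopSolution S K x₀ v₀ τ x v →
        ∀ t ∈ timeInterval τ, K.InMargin w θ t (x t) (v t)) ∧
      ∀ (τ : ℝ) (x v : ℝ → Fin n → ℝ), (0 < τ → IsClosedLoopSolution S K x₀ v₀ τ x v) →
        ∃ x' v' : ℝ → Fin n → ℝ, IsClosedLoopSolution S K x₀ v₀ ⊤ x' v' ∧
          ∀ t ∈ timeInterval τ, x' t = x t ∧ v' t = v t := by
  obtain ⟨w, θ, hw0, hw, hθ0, hθ1, hinit, hstep⟩ := hK.exists_margins S hx₀ hv₀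
  have hmargin : ∀ (τ : EReal) (x v : ℝ → Fin n → ℝ), IsClosedLoopSolution S K x₀ v₀ τ x v →
      ∀ t ∈ timeInterval τ, K.InMargin w θ t (x t) (v t) := by
    intro τ x v h t ht
    have hsub := Icc_subset_timeInterval ht
    exact hK.inMargin_of_step (S := S) hw0 hθ0
      (fun r hr => (h.deriv_x r (hsub hr)).continuousWithinAt.mono Icc_subset_Ici_self)
      (h.continuousOn_v.mono hsub) (by rw [h.init_x, h.init_v]; exact hinit)
      (fun r hr _ => h.obeysLoopAt (hsub hr))
      (fun q hq => hstep q x v h.init_x h.init_v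
        (h.continuousOn_v.mono ((Icc_subset_Icc_right hq).trans hsub))) t ⟨ht.1, le_rfl⟩
  refine ⟨w, θ, hw0, hθ0, hmargin, fun τ x v h => ?_⟩
  have hmem : ∀ {t : ℝ}, t ∈ timeInterval τ ↔ t ∈ Ico 0 τ := by
    intro t
    simp [timeInterval]
  have hw2 : 0 < w / 2 := by linarith
  have hw2' : 2 * (w / 2) ≤ δ := by linarith
  have hθ2 : 0 < θ / 2 := by linarith
  have hθ2' : θ / 2 ≤ 1 := by linarith
  have hyc : ContinuousOn (fun t => (x t, v t)) (Ico 0 τ) := fun t ht => by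
    have h' := h (ht.1.trans_lt ht.2)
    have hv := h'.continuousOn_v t (hmem.2 ht)
    exact ((h'.deriv_x t (hmem.2 ht)).continuousWithinAt.mono Ico_subset_Ici_self).prodMk
      (hv.mono fun r hr => hmem.2 hr)
  obtain ⟨Y, hYc, hY, hYagree⟩ := hK.exists_truncated_extension S hw2 hw2' hθ2 hθ2' τ
    (y₀ := (x₀, v₀)) hyc fun t ht => by
      have h' := h (ht.1.trans_lt ht.2)
      have hsub := Icc_subset_timeInterval (hmem.2 ht)
      have := hK.integral_equation (S := S) (x := x) (v := v) hw2 hw2' hθ2 hθ2' le_rfl ht.1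
        (h'.continuousOn_v.mono hsub) (fun r hr => h'.obeysLoopAt (hsub hr))
        (fun r hr => (hmargin τ x v h' r (hsub hr)).mono (by linarith) (by linarith))
      rw [this, h'.init_x, h'.init_v]
      abel
  have hY0 : Y 0 = (x₀, v₀) := by simpa using hY 0 le_rfl
  have hobey : ∀ t, 0 ≤ t → K.InMargin (w / 2) (θ / 2) t (Y t).1 (Y t).2 →
      ObeysLoopAt S K (fun s => (Y s).1) (fun s => (Y s).2) t := fun t ht hm =>
    hK.obeysLoopAt_of_integral_eq hw2 hw2' hθ2 hθ2' hYc hY ht hm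
  have hYm : ∀ t, 0 ≤ t → K.InMargin w θ t (Y t).1 (Y t).2 := fun t ht =>
    hK.inMargin_of_step (S := S) (s := t) hw0 hθ0 (x := fun s => (Y s).1)
      (v := fun s => (Y s).2) hYc.fst.continuousOn hYc.snd.continuousOn
      (by simp only [hY0]; exact hinit) (fun r hr => hobey r hr.1)
      (fun q _ => hstep q _ _ (by simp only [hY0]) (by simp only [hY0]) hYc.snd.continuousOn)
      t ⟨ht, le_rfl⟩
  refine ⟨fun t => (Y t).1, fun t => (Y t).2,
    isClosedLoopSolution_of_obeysLoopAt (by simp only [hY0]) (by simp only [hY0])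
      hYc.snd.continuousOn fun t ht => hobey t ht.1
        ((hYm t ht.1).mono (by linarith) (by linarith)), fun t ht => ?_⟩
  have := hYagree t (hmem.1 ht)
  exact ⟨congrArg Prod.fst this, congrArg Prod.snd this⟩

end FunnelControl

end

theorem mainTheorem2 {n : ℕ}
    -- the plant, the constraints, and initial data with compatible constraints
    (S : FunnelControl.ELSystem n) (R : FunnelControl.OutputConstraints n)
    (x₀ v₀ : Fin n → ℝ) (h_init : R.InitiallyCompatible x₀)
    -- the planned funnel
    (μ kc : ℝ) (hμ : 0 < μ) (hkc : 0 < kc) (pL pU : Fin n → ℝ → ℝ)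
    (hpL : ∀ i, FunnelControl.IsModificationSignal μ kc (R.etaL i) (pL i))
    (hpU : ∀ i, FunnelControl.IsModificationSignal μ kc (R.etaU i) (pU i))
    -- the controller, with funnel boundaries from the planning scheme
    (K : FunnelControl.Controller n) (hrL : K.rL = R.rhoL pL) (hrU : K.rU = R.rhoU pU)
    (hkx : 0 < K.kx) (hkv : 0 < K.kv)
    -- velocity performance functions
    (hγ : ∀ i, FunnelControl.IsC1Bounded (K.γ i))
    (hγ_pos : ∀ i, ∃ c : ℝ, 0 < c ∧ ∀ t : ℝ, 0 ≤ t → c ≤ K.γ i t)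
    (hγ_init : ∀ i, |K.ev 0 x₀ v₀ i| < K.γ i 0) :
    -- there is a closed-loop solution for all times
    (∃ x v : ℝ → Fin n → ℝ, FunnelControl.IsClosedLoopSolution S K x₀ v₀ ⊤ x v) ∧
    -- every closed-loop solution extends to all times
    (∀ (τ : EReal) (x v : ℝ → Fin n → ℝ), 0 < τ →
      FunnelControl.IsClosedLoopSolution S K x₀ v₀ τ x v →
      ∃ x' v' : ℝ → Fin n → ℝ, FunnelControl.IsClosedLoopSolution S K x₀ v₀ ⊤ x' v' ∧
        ∀ t ∈ FunnelControl.timeInterval τ, x' t = x t ∧ v' t = v t) ∧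
    -- every closed-loop solution stays in both funnels, and all signals are bounded
    (∀ x v : ℝ → Fin n → ℝ, FunnelControl.IsClosedLoopSolution S K x₀ v₀ ⊤ x v →
      (∀ t : ℝ, 0 ≤ t → ∀ i, R.rhoL pL i t < x t i ∧ x t i < R.rhoU pU i t) ∧
      (∀ t : ℝ, 0 ≤ t → ∀ i, |K.ev t (x t) (v t) i| < K.γ i t) ∧
      FunnelControl.AllSignalsBounded S K pL pU x v) := by
  obtain ⟨A, L, δ, hK⟩ := FunnelControl.exists_regularFunnel R h_init hμ hkc hpL hpU K hrL hrU
    hkx hkv hγ hγ_pos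
  have hx₀ : ∀ i, 0 < x₀ i - K.rL i 0 ∧ 0 < K.rU i 0 - x₀ i := fun i => by
    obtain ⟨-, ⟨h1, h2⟩, h3, h4⟩ := h_init i
    rw [hrL, hrU, FunnelControl.OutputConstraints.rhoL, FunnelControl.OutputConstraints.rhoU,
      (hpL i).map_zero, (hpU i).map_zero, sub_zero, add_zero, sub_pos, sub_pos]
    exact ⟨max_lt h3 h1, lt_min h4 h2⟩
  have hγ_gt : ∀ i t, 0 ≤ t → 0 < K.γ i t := fun i t ht => hK.δ_pos.trans_le (hK.le_γ i t ht)
  have hv₀ : ∀ i, |K.evHat 0 x₀ v₀ i| < 1 := fun i => by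
    rw [FunnelControl.Controller.evHat, abs_div, abs_of_pos (hγ_gt i 0 le_rfl),
      div_lt_one (hγ_gt i 0 le_rfl)]
    exact hγ_init i
  obtain ⟨w, θ, hw, hθ, hmargin, hext⟩ := hK.exists_margins_and_extension S hx₀ hv₀
  refine ⟨?_, fun τ x v hτ h => ?_, fun x v h => ?_⟩
  · obtain ⟨x, v, h, -⟩ := hext 0 (fun _ => x₀) (fun _ => v₀) fun h => absurd h (lt_irrefl _)
    exact ⟨x, v, h⟩
  · induction τ with
    | bot => exact absurd hτ not_lt_bot
    | coe τ => exact hext τ x v fun _ => h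
    | top => exact ⟨x, v, h, fun t _ => ⟨rfl, rfl⟩⟩
  have hm : ∀ t, 0 ≤ t → K.InMargin w θ t (x t) (v t) := fun t ht =>
    hmargin ⊤ x v h t (by rw [FunnelControl.timeInterval_top]; exact ht)
  obtain ⟨B, hB, hbound⟩ := hK.exists_bounds S hw hθ
  have hb := fun t ht => hbound t ht _ _ (hm t ht)
  refine ⟨fun t ht i => ?_, fun t ht i => ?_, ?_⟩
  · have h1 := (hm t ht i).1
    rw [hrL, hrU] at h1
    exact ⟨by linarith [h1.1], by linarith [h1.2]⟩
  · rw [FunnelControl.ev_eq_evHat_mul hK ht, abs_mul, abs_of_pos (hγ_gt i t ht)]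
    exact mul_lt_of_lt_one_left (hγ_gt i t ht) ((hm t ht i).2.trans_lt (by linarith))
  · exact
      { pL_bdd := fun i => (FunnelControl.isLipschitzSignal_modification hμ hkc
          ((R.hU_c1 i).isLipschitzSignal.sub (R.sL_c1 i).isLipschitzSignal)
          (sub_pos.2 (h_init i).1.1) (hpL i)).1
        pU_bdd := fun i => (FunnelControl.isLipschitzSignal_modification hμ hkc
          ((R.sU_c1 i).isLipschitzSignal.sub (R.hL_c1 i).isLipschitzSignal)
          (sub_pos.2 (h_init i).1.2) (hpU i)).1
        rL_bdd := fun i => ⟨A, hK.abs_rL_le i⟩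
        rU_bdd := fun i => ⟨A, hK.abs_rU_le i⟩
        x_bdd := ⟨B, fun t ht => (hb t ht).1⟩
        v_bdd := ⟨B, fun t ht => (hb t ht).2.1⟩
        acceleration_bdd := ⟨B, fun t ht hd => by
          have h1 := (h.obeysLoopAt (by rw [FunnelControl.timeInterval_top]; exact ht)).2 hd
          rw [h1.derivWithin (uniqueDiffOn_Ici 0 t ht)]
          exact (hb t ht).2.2.2.2.2.2.2.2.2.2.2⟩
        xHat_bdd := ⟨B, fun t ht => (hb t ht).2.2.1⟩
        xiX_bdd := ⟨B, fun t ht => (hb t ht).2.2.2.1⟩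
        epsX_bdd := ⟨B, fun t ht => (hb t ht).2.2.2.2.1⟩
        vd_bdd := ⟨B, fun t ht => (hb t ht).2.2.2.2.2.1⟩
        ev_bdd := ⟨B, fun t ht => (hb t ht).2.2.2.2.2.2.1⟩
        evHat_bdd := ⟨B, fun t ht => (hb t ht).2.2.2.2.2.2.2.1⟩
        xiV_bdd := ⟨B, fun t ht => (hb t ht).2.2.2.2.2.2.2.2.1⟩
        epsV_bdd := ⟨B, fun t ht => (hb t ht).2.2.2.2.2.2.2.2.2.1⟩
        u_bdd := ⟨B, fun t ht => (hb t ht).2.2.2.2.2.2.2.2.2.2.1⟩ }
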